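/- **Setting.** Let $1\le n<p$, and let $(x_1,y_1),\dots,(x_n,y_n)$ be i.i.d. copies of a random pair $(x,y)\in\mathbb R^p\times\mathbb R$ with $\mathbb E[x]=0$, $\mathbb E[y]=0$ and $\mathbb E[xx^\top]=\Sigma=\mathrm{diag}(\lambda_1,\dots,\lambda_p)$, where $\lambda_1\ge\dots\ge\lambda_p>0$. Let $X=(x_1,\dots,x_n)^\top\in\mathbb R^{n\times p}$, $\mathbf y=(y_1,\dots,y_n)^\top$, and let $\theta^\star$ be a minimizer of $\theta\mapsto\mathbb E[(y-x^\top\theta)^2]$. Fix constants $\sigma_x,\sigma_y,\sigma>0$ and $\kappa$, and suppose that: 1. $x=\Sigma^{1/2}u$, where $u$ has independent components and $\mathbb E[\exp(\phi^\top u)]\le\exp(\sigma_x^2\|\phi\|^2/2)$ for all $\phi\in\mathbb R^p$; 2. $\Pr[(\Sigma^{-1/2}X^\top\phi)_i\in[a,a']]\le\kappa|a'-a|$ for every unit vector $\phi\in\mathbb R^n$, all real $a\le a'$ and all $i\in\{1,\dots,p\}$; 3. almost surely, $\mathbb E[\exp(t(y-x^\top\theta^\star))\mid x]\le\exp(\sigma_y^2t^2/2)$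 for all $t\in\mathbb R$, and $\mathbb E[(y-x^\top\theta^\star)^2\mid x]=\sigma^2$. For $0\le j<p$ put $s_j=\sum_{i>j}\lambda_i$, $r_j=s_j/\lambda_{j+1}$ and $R_j=s_j^2/\sum_{i>j}\lambda_i^2$. For $b>0$ let $k=\min\{0\le j<p: r_j\ge bn\}$, with $k=\infty$ if there is no such $j$. For a deterministic $\theta(0)\in\mathbb R^p$ let $w=\theta(0)/\sqrt{\|\theta(0)\|}$ (with $w=0$ if $\theta(0)=0$). Let $X=UDV^\top$ be a singular value decomposition, with $U\in\mathbb R^{n\times n}$ and $V\in\mathbb R^{p\times p}$ orthogonal and $D\in\mathbb R^{n\times p}$ rectangular diagonal with nonnegative diagonal entries in descending order. Let $D^\dagger$ be the pseudo-inverse of $D$, let $\widetilde{\mathbf y}=D^\dagger U^\top\mathbf y$ and $\widetilde w=V^\top w$, let $\widetilde w_{n+1:p}$ be the vector of the last $p-n$ coordinates of $\widetilde w$, and let $$\alpha^\star=\sqrt{\frac{8\|\widetilde w_{n+1:p}\|^2+\sqrt{64\|\widetilde w_{n+1:p}\|^4+1296\|\widetilde{\mathbf y}\|^2}}{81}}.$$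 **Lemma.** There are positive constants $c_0,\dots,c_5$ and $b_0$, depending only on $\sigma_x,\sigma_y,\sigma,\kappa$, such that for every $b\ge b_0$ the following holds in the above setting. For every $\delta\in(e^{-c_0\sqrt n},1)$, if $p\ge c_1(n+k)$ (in particular $k<\infty$), $n\ge c_2\max\{k,s_k\}$ and $\|\theta^\star\|,\|w\|\le c_3$, then with probability at least $1-c_4\delta$, $$\left|\frac{\alpha^\star}{\frac{2\sqrt\sigma\,n^{1/4}}{3s_k^{1/4}}}-1\right|\le c_5\left[\sqrt{\frac n{R_k}}+\frac n{r_k}+\sqrt{\frac{s_k}n}+\sqrt{\frac{\log(2/\delta)}n}+\frac kn\right].$$ -/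

import Mathlib

open MeasureTheory ProbabilityTheory
open scoped RealInnerProductSpace Matrix

noncomputable section

namespace LinReg

/-! ### Effective ranks

The eigenvalues `λ₁ ≥ … ≥ λ_p` are indexed by `Fin p`, so that `λ_{j+1}` is `lam ⟨j, _⟩` and the
(one-based) indices `i > j` are the `i : Fin p` with `j ≤ i.val`. -/

/-- The tail sum `s_j = ∑_{i > j} λ_i`. -/
def tailSum {p : ℕ} (lam : Fin p → ℝ) (j : ℕ) : ℝ :=
  ∑ i : Fin p with j ≤ i.val, lam i

/-- The effective rank `r_j = s_j / λ_{j+1}`, for `j < p` (it is only used there). -/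
def effRank {p : ℕ} (lam : Fin p → ℝ) (j : ℕ) : ℝ :=
  if h : j < p then tailSum lam j / lam ⟨j, h⟩ else 0

/-- The effective rank `R_j = s_j ^ 2 / ∑_{i > j} λ_i ^ 2`, for `j < p`. -/
def effRankSq {p : ℕ} (lam : Fin p → ℝ) (j : ℕ) : ℝ :=
  tailSum lam j ^ 2 / ∑ i : Fin p with j ≤ i.val, lam i ^ 2

/-- The index `k = min {j ≥ 0 : r_j ≥ b n}`, where the minimum of the empty set is `∞`. -/
def splitIndex {p : ℕ} (lam : Fin p → ℝ) (b : ℝ) (n : ℕ) : ℕ∞ :=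
  sInf ((fun j : ℕ => (j : ℕ∞)) '' {j : ℕ | j < p ∧ b * n ≤ effRank lam j})

/-! ### The data -/

/-- The data matrix `X = (x₁, …, x_n)ᵀ`. -/
def dataMatrix {n p : ℕ} (x : Fin n → EuclideanSpace ℝ (Fin p)) : Matrix (Fin n) (Fin p) ℝ :=
  Matrix.of fun i j => x i j

/-- The conditions on the data. `ν` is the law of a pair `(x, y)`, and the samples are
`(xs i, ys i)`. -/
structure DataAssumptions {Ω : Type*} [MeasurableSpace Ω] (μ : Measure Ω) {n p : ℕ}
    (ν : Measure (EuclideanSpace ℝ (Fin p) × ℝ))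
    (xs : Fin n → Ω → EuclideanSpace ℝ (Fin p)) (ys : Fin n → Ω → ℝ)
    (lam : Fin p → ℝ) (θs : EuclideanSpace ℝ (Fin p)) (σx σy σ κ : ℝ) : Prop where
  /-- The eigenvalues are positive and in descending order. -/
  lam_pos : ∀ i, 0 < lam i
  lam_antitone : Antitone lam
  /-- The samples are i.i.d. with law `ν`. -/
  measurable_xs : ∀ i, Measurable (xs i)
  measurable_ys : ∀ i, Measurable (ys i)
  indep : iIndepFun (fun i ω => (xs i ω, ys i ω)) μ
  law : ∀ i, μ.map (fun ω => (xs i ω, ys i ω)) = ν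
  /-- Features and responses are centred. -/
  mean_x : ∀ i, ∫ z, z.1 i ∂ν = 0
  mean_y : ∫ z, z.2 ∂ν = 0
  /-- The covariance matrix of the features is `Σ = diag (λ₁, …, λ_p)`. -/
  covariance : ∀ i j, ∫ z, z.1 i * z.1 j ∂ν = Matrix.diagonal lam i j
  /-- `θs` is an optimal linear regressor. -/
  optimal : ∀ θ : EuclideanSpace ℝ (Fin p),
    ∫ z, (z.2 - ⟪z.1, θs⟫) ^ 2 ∂ν ≤ ∫ z, (z.2 - ⟪z.1, θ⟫) ^ 2 ∂ν
  /-- The vector `u = Σ^{-1/2} x` has independent components. -/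
  indep_u : iIndepFun (fun (i : Fin p) (z : EuclideanSpace ℝ (Fin p) × ℝ) =>
    (Real.sqrt (lam i))⁻¹ * z.1 i) ν
  /-- `u` is sub-Gaussian: `E[exp (φᵀ u)] ≤ exp (σx² ‖φ‖² / 2)` for all `φ`. -/
  subgaussian_u_integrable : ∀ φ : EuclideanSpace ℝ (Fin p),
    Integrable (fun z => Real.exp (∑ i, φ i * ((Real.sqrt (lam i))⁻¹ * z.1 i))) ν
  subgaussian_u : ∀ φ : EuclideanSpace ℝ (Fin p),
    ∫ z, Real.exp (∑ i, φ i * ((Real.sqrt (lam i))⁻¹ * z.1 i)) ∂ν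
      ≤ Real.exp (σx ^ 2 * ‖φ‖ ^ 2 / 2)
  /-- Small ball: `P[(Σ^{-1/2} Xᵀ φ)_i ∈ [s, t]] ≤ κ |t - s|` for every unit vector `φ`. -/
  small_ball : ∀ φ : EuclideanSpace ℝ (Fin n), ‖φ‖ = 1 → ∀ s t : ℝ, s ≤ t → ∀ i : Fin p,
    μ.real {ω | (Matrix.diagonal (fun l => (Real.sqrt (lam l))⁻¹) *ᵥ
      ((dataMatrix fun l => xs l ω)ᵀ *ᵥ φ.ofLp)) i ∈ Set.Icc s t} ≤ κ * |t - s|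
  /-- `y - xᵀ θs` is sub-Gaussian conditionally on `x`. -/
  subgaussian_noise_integrable : ∀ t : ℝ,
    Integrable (fun z => Real.exp (t * (z.2 - ⟪z.1, θs⟫))) ν
  subgaussian_noise : ∀ t : ℝ,
    ν[fun z => Real.exp (t * (z.2 - ⟪z.1, θs⟫)) | MeasurableSpace.comap Prod.fst inferInstance]
      ≤ᵐ[ν] fun _ => Real.exp (σy ^ 2 * t ^ 2 / 2)
  /-- The conditional variance of `y - xᵀ θs` given `x` is `σ²`. -/
  variance_noise :
    ν[fun z => (z.2 - ⟪z.1, θs⟫) ^ 2 | MeasurableSpace.comap Prod.fst inferInstance]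
      =ᵐ[ν] fun _ => σ ^ 2

/-! ### The random scale -/

/-- `w = θ(0) / √‖θ(0)‖`; it is `0` for `θ(0) = 0`. -/
def initVec {p : ℕ} (θ0 : EuclideanSpace ℝ (Fin p)) : EuclideanSpace ℝ (Fin p) :=
  (Real.sqrt ‖θ0‖)⁻¹ • θ0

/-- `X = U D Vᵀ` is a singular value decomposition: `U`, `V` are orthogonal and `D` is rectangular
diagonal, with nonnegative diagonal entries in descending order. -/
structure IsSVD {n p : ℕ} (X : Matrix (Fin n) (Fin p) ℝ) (U : Matrix (Fin n) (Fin n) ℝ)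
    (D : Matrix (Fin n) (Fin p) ℝ) (V : Matrix (Fin p) (Fin p) ℝ) : Prop where
  eq : X = U * D * Vᵀ
  orthogonal_left : U ∈ Matrix.orthogonalGroup (Fin n) ℝ
  orthogonal_right : V ∈ Matrix.orthogonalGroup (Fin p) ℝ
  diagonal : ∀ (i : Fin n) (j : Fin p), i.val ≠ j.val → D i j = 0
  nonneg : ∀ (i : Fin n) (j : Fin p), 0 ≤ D i j
  descending : ∀ (i i' : Fin n) (j j' : Fin p), i.val = j.val → i'.val = j'.val → i ≤ i' →
    D i' j' ≤ D i j

/-- The pseudo-inverse `D†` of a rectangular diagonal matrix `D`: transpose and invert the nonzero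
diagonal entries (in Lean `0⁻¹ = 0`). -/
def diagPinv {n p : ℕ} (D : Matrix (Fin n) (Fin p) ℝ) : Matrix (Fin p) (Fin n) ℝ :=
  Dᵀ.map fun t => t⁻¹

/-- `ỹ = D† Uᵀ y`. -/
def yTilde {n p : ℕ} (U : Matrix (Fin n) (Fin n) ℝ) (D : Matrix (Fin n) (Fin p) ℝ)
    (y : Fin n → ℝ) : EuclideanSpace ℝ (Fin p) :=
  WithLp.toLp 2 (diagPinv D *ᵥ (Uᵀ *ᵥ y))

/-- The vector `w̃_{n+1:p}` of the last `p - n` coordinates of `w̃ = Vᵀ w` (padded by zeros). -/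
def wTildeTail {p : ℕ} (n : ℕ) (V : Matrix (Fin p) (Fin p) ℝ)
    (w : EuclideanSpace ℝ (Fin p)) : EuclideanSpace ℝ (Fin p) :=
  WithLp.toLp 2 fun j => if n ≤ j.val then (Vᵀ *ᵥ w.ofLp) j else 0

/-- The scale
`α⋆ = √((8 ‖w̃_{n+1:p}‖² + √(64 ‖w̃_{n+1:p}‖⁴ + 1296 ‖ỹ‖²)) / 81)`. -/
def alphaStar {n p : ℕ} (U : Matrix (Fin n) (Fin n) ℝ) (D : Matrix (Fin n) (Fin p) ℝ)
    (V : Matrix (Fin p) (Fin p) ℝ) (y : Fin n → ℝ) (w : EuclideanSpace ℝ (Fin p)) : ℝ :=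
  Real.sqrt ((8 * ‖wTildeTail n V w‖ ^ 2 +
    Real.sqrt (64 * ‖wTildeTail n V w‖ ^ 4 + 1296 * ‖yTilde U D y‖ ^ 2)) / 81)

end LinReg

end

/-!
Write `u_{l,i} = λ_i^{-1/2} x_{l,i}` for the whitened features and `ε = y - X θ⋆` for the noise.
Since `α⋆² = (8 ‖w̃‖² + √(64 ‖w̃‖⁴ + 1296 ‖ỹ‖²)) / 81` lies between `4 ‖ỹ‖ / 9` and
`4 ‖ỹ‖ / 9 + 16 ‖w‖² / 81`, everything reduces to `‖ỹ‖ ≈ T`, where `T = σ √(n / s_k)`; the error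
terms of size `1 / T` are of order `√(s_k / n)`. The vector `ỹ = X† y` is `X† X θ⋆ + X† ε`, and
`X† X` is a contraction, so `‖ỹ‖` and `‖X† ε‖` differ by at most `‖θ⋆‖`.

Split the features into the first `k` (the head) and the others (the tail), and let
`A_k = ∑_{i > k} λ_i z_i z_iᵀ` be the Gram matrix of the tail, with `z_i = (u_{1,i}, …, u_{n,i})`.
It satisfies `‖A_k - s_k I‖ ≤ ρ s_k` with `ρ` of order `√(n / R_k) + n / r_k`
(`gram_concentration`). As `X Xᵀ ≥ A_k`, this gives `‖X† ε‖² ≤ ‖ε‖² / ((1 - ρ) s_k)`. Conversely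
`‖X† ε‖ ≥ ⟨ε, v⟩ / ‖Xᵀ v‖` for all `v`, and the component `v` of `ε` orthogonal to the head columns
gives `‖X† ε‖² ≥ ‖v‖² / ((1 + ρ) s_k)`. The lost part `‖ε‖² - ‖v‖²` is of order `k + log (2 / δ)`,
because the head columns are well conditioned (`covariance_concentration`) and nearly
uncorrelated with `ε` (`cross_concentration`, where optimality of `θ⋆` makes the mean vanish).
The two bounds are `norm_yTilde_sq_bounds`. Finally `‖ε‖² ≈ n σ²` (`noise_concentration`).

All four concentration facts come from Bernstein's inequality (`bernstein`) for squares and products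
of sub-Gaussian variables, made uniform over unit vectors by a `1/2`-net of at most `5 ^ d` points
(`uniform_quadratic`, `uniform_linear`). For the Gram matrix, the `z_i` are independent of
each other because the array `u` has independent rows with independent entries
(`iIndepFun_columns`).
-/

-- instance arguments are fixed once for all lemmas of a section
set_option linter.unusedSectionVars false

noncomputable section

namespace LinReg

/-! ### Sub-exponential random variables -/

section Concentration

variable {Ω : Type*} [MeasurableSpace Ω] {μ : Measure Ω}

/-- The random variable `Y` is sub-exponential at scale `a`: `E[exp (|Y| / a)] ≤ M`. -/
structure HasExpMoment (Y : Ω → ℝ) (a M : ℝ) (μ : Measure Ω) : Prop where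
  measurable : Measurable Y
  integrable : Integrable (fun ω => Real.exp (|Y ω| / a)) μ
  le : ∫ ω, Real.exp (|Y ω| / a) ∂μ ≤ M

lemma exp_le_one_add_add (x : ℝ) : Real.exp x ≤ 1 + x + x ^ 2 * Real.exp |x| := by
  have h := Complex.norm_exp_sub_sum_le_norm_mul_exp (x : ℂ) 2
  have h2 : Complex.exp (x : ℂ) - ∑ m ∈ Finset.range 2, (x : ℂ) ^ m / (m.factorial : ℂ)
      = ((Real.exp x - (1 + x) : ℝ) : ℂ) := by
    simp [Finset.sum_range_succ]
  rw [h2, Complex.norm_real, Complex.norm_real, Real.norm_eq_abs, Real.norm_eq_abs, sq_abs] at h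
  have := (abs_le.1 h).2
  linarith

/-- For `|t| ≤ 1 / (2 a)`, the quadratic remainder of `exp (t y)` is absorbed by
`exp (|y| / a)`. -/
lemma exp_mul_le_of_abs_le {a t : ℝ} (ha : 0 < a) (ht : |t| ≤ 1 / (2 * a)) (y : ℝ) :
    Real.exp (t * y) ≤ 1 + t * y + 8 * a ^ 2 * t ^ 2 * Real.exp (|y| / a) := by
  refine (exp_le_one_add_add (t * y)).trans ?_
  have hv : 0 ≤ |y| / a := by positivity
  have h1 : Real.exp |t * y| ≤ Real.exp (|y| / a / 2) := by
    apply Real.exp_le_exp.2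
    rw [abs_mul]
    calc |t| * |y| ≤ 1 / (2 * a) * |y| := by gcongr
      _ = |y| / a / 2 := by field_simp
  have h2 : (|y| / a) ^ 2 ≤ 8 * Real.exp (|y| / a / 2) := by
    have := Real.quadratic_le_exp_of_nonneg (x := |y| / a / 2) (by positivity)
    nlinarith
  have h3 : (t * y) ^ 2 = t ^ 2 * a ^ 2 * (|y| / a) ^ 2 := by
    rw [div_pow, sq_abs]; field_simp
  have h4 : Real.exp (|y| / a) = Real.exp (|y| / a / 2) * Real.exp (|y| / a / 2) := by
    rw [← Real.exp_add]; ring_nf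
  rw [h3, h4]
  have := Real.exp_pos (|y| / a / 2)
  calc _ ≤ 1 + t * y + t ^ 2 * a ^ 2 * (8 * Real.exp (|y| / a / 2)) * Real.exp (|y| / a / 2) := by
        gcongr
    _ = _ := by ring

namespace HasExpMoment

lemma integrable_self {Y : Ω → ℝ} {a M : ℝ} (h : HasExpMoment Y a M μ) (ha : 0 < a) :
    Integrable Y μ := by
  refine (h.integrable.const_mul a).mono' h.measurable.aestronglyMeasurable
    (Filter.Eventually.of_forall fun ω => ?_)
  have := Real.add_one_le_exp (|Y ω| / a)
  rw [Real.norm_eq_abs]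
  calc |Y ω| = a * (|Y ω| / a) := by field_simp
    _ ≤ a * Real.exp (|Y ω| / a) := by gcongr; linarith

lemma neg {Y : Ω → ℝ} {a M : ℝ} (h : HasExpMoment Y a M μ) :
    HasExpMoment (fun ω => -Y ω) a M μ :=
  ⟨h.measurable.neg, by simpa using h.integrable, by simpa using h.le⟩

lemma integrable_exp_mul [IsProbabilityMeasure μ] {Y : Ω → ℝ} {a M : ℝ} (h : HasExpMoment Y a M μ)
    (ha : 0 < a) {t : ℝ} (ht : |t| ≤ 1 / (2 * a)) :
    Integrable (fun ω => Real.exp (t * Y ω)) μ := by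
  have hm := h.measurable
  refine (((integrable_const (1 : ℝ)).add ((h.integrable_self ha).const_mul t)).add
    (h.integrable.const_mul (8 * a ^ 2 * t ^ 2))).mono' (by fun_prop)
    (Filter.Eventually.of_forall fun ω => ?_)
  rw [Real.norm_eq_abs, abs_of_pos (Real.exp_pos _)]
  exact exp_mul_le_of_abs_le ha ht _

/-- A centred sub-exponential variable has a sub-Gaussian moment generating function near `0`. -/
lemma mgf_le [IsProbabilityMeasure μ] {Y : Ω → ℝ} {a M : ℝ} (h : HasExpMoment Y a M μ)
    (ha : 0 < a) (h0 : ∫ ω, Y ω ∂μ = 0) {t : ℝ} (ht : |t| ≤ 1 / (2 * a)) :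
    mgf Y μ t ≤ Real.exp (8 * M * a ^ 2 * t ^ 2) := by
  have hi1 : Integrable (fun ω => 1 + t * Y ω) μ :=
    (integrable_const (1 : ℝ)).add ((h.integrable_self ha).const_mul t)
  have hi2 := h.integrable.const_mul (8 * a ^ 2 * t ^ 2)
  calc mgf Y μ t ≤ ∫ ω, (1 + t * Y ω + 8 * a ^ 2 * t ^ 2 * Real.exp (|Y ω| / a)) ∂μ :=
        integral_mono (h.integrable_exp_mul ha ht) (hi1.add hi2)
          fun ω => exp_mul_le_of_abs_le ha ht _
    _ = 1 + 8 * a ^ 2 * t ^ 2 * ∫ ω, Real.exp (|Y ω| / a) ∂μ := by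
        rw [integral_add hi1 hi2, integral_add (integrable_const _)
          ((h.integrable_self ha).const_mul t), integral_const_mul, integral_const_mul, h0]
        simp
    _ ≤ 1 + 8 * a ^ 2 * t ^ 2 * M := by gcongr; exact h.le
    _ ≤ _ := by
        have := Real.add_one_le_exp (8 * M * a ^ 2 * t ^ 2)
        linarith

end HasExpMoment

lemma one_sided_bernstein [IsProbabilityMeasure μ] {ι : Type*} (s : Finset ι) {Y : ι → Ω → ℝ}
    {a M L V h : ℝ} {lam : ι → ℝ} (hind : iIndepFun Y μ) (hY : ∀ i, HasExpMoment (Y i) a M μ)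
    (h0 : ∀ i, ∫ ω, Y i ω ∂μ = 0) (ha : 0 < a) (hM : 0 ≤ M) (hlam0 : ∀ i ∈ s, 0 ≤ lam i)
    (hlam : ∀ i ∈ s, lam i ≤ L) (hV : ∑ i ∈ s, lam i ^ 2 ≤ V) (hL : 0 < L) (hh : 0 < h) :
    μ.real {ω | (4 * M + 8) * a * (√(h * V) + h * L) ≤ ∑ i ∈ s, lam i * Y i ω}
      ≤ Real.exp (-4 * h) := by
  have hV0 : 0 ≤ V := (Finset.sum_nonneg fun i _ => sq_nonneg (lam i)).trans hV
  have hq : 0 ≤ √(V / h) := Real.sqrt_nonneg _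
  -- the exponential tilt balancing the Gaussian and the exponential regimes
  set t : ℝ := 1 / (2 * a * (L + √(V / h))) with ht
  have ht0 : 0 < t := by positivity
  have hti : ∀ i ∈ s, |t * lam i| ≤ 1 / (2 * a) := by
    intro i hi
    rw [abs_of_nonneg (mul_nonneg ht0.le (hlam0 i hi)), ht, div_mul_eq_mul_div, one_mul,
      div_le_div_iff₀ (by positivity) (by positivity)]
    have := hlam i hi
    nlinarith [mul_nonneg (mul_nonneg zero_le_two ha.le) hq]
  have hZ : iIndepFun (fun i ω => lam i * Y i ω) μ :=
    hind.comp (fun i x => lam i * x) fun i => by fun_prop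
  have hmeas : ∀ i, Measurable (fun ω => lam i * Y i ω) := fun i => (hY i).measurable.const_mul _
  have hint : ∀ i ∈ s, Integrable (fun ω => Real.exp (t * (lam i * Y i ω))) μ := by
    intro i hi
    simpa [mul_assoc] using (hY i).integrable_exp_mul ha (hti i hi)
  have hmgf : mgf (∑ i ∈ s, fun ω => lam i * Y i ω) μ t ≤ Real.exp (2 * M * h) := by
    rw [hZ.mgf_sum hmeas]
    calc ∏ i ∈ s, mgf (fun ω => lam i * Y i ω) μ t
        ≤ ∏ i ∈ s, Real.exp (8 * M * a ^ 2 * (t * lam i) ^ 2) := by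
          refine Finset.prod_le_prod (fun i _ => mgf_nonneg) fun i hi => ?_
          have := (hY i).mgf_le ha (h0 i) (hti i hi)
          simpa [mgf, mul_assoc] using this
      _ = Real.exp (8 * M * a ^ 2 * t ^ 2 * ∑ i ∈ s, lam i ^ 2) := by
          rw [← Real.exp_sum, Finset.mul_sum]
          congr 1
          exact Finset.sum_congr rfl fun i _ => by ring
      _ ≤ Real.exp (2 * M * h) := by
          apply Real.exp_le_exp.2
          have h1 : 4 * a ^ 2 * t ^ 2 * V ≤ h := by
            have : V = h * √(V / h) ^ 2 := by rw [Real.sq_sqrt (by positivity)]; field_simp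
            have h2 : 2 * a * t * √(V / h) ≤ 1 := by
              rw [ht, mul_one_div, div_mul_eq_mul_div, div_le_one (by positivity)]
              nlinarith
            have h3 : 0 ≤ 2 * a * t * √(V / h) := by positivity
            calc 4 * a ^ 2 * t ^ 2 * V = h * (2 * a * t * √(V / h)) ^ 2 := by
                  rw [show h * (2 * a * t * √(V / h)) ^ 2 = 4 * a ^ 2 * t ^ 2 * (h * √(V / h) ^ 2) by
                    ring, ← this]
              _ ≤ h * 1 := by gcongr; nlinarith
              _ = h := mul_one h
          calc 8 * M * a ^ 2 * t ^ 2 * ∑ i ∈ s, lam i ^ 2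
              ≤ 8 * M * a ^ 2 * t ^ 2 * V := by gcongr
            _ = 2 * M * (4 * a ^ 2 * t ^ 2 * V) := by ring
            _ ≤ _ := by gcongr
  have hch := measure_ge_le_exp_mul_mgf (μ := μ) (X := ∑ i ∈ s, fun ω => lam i * Y i ω)
    ((4 * M + 8) * a * (√(h * V) + h * L)) ht0.le
    (hZ.integrable_exp_mul_sum hmeas hint)
  have hexp : t * ((4 * M + 8) * a * (√(h * V) + h * L)) = (2 * M + 4) * h := by
    have : √(h * V) = h * √(V / h) := by
      rw [show h * V = h ^ 2 * (V / h) by field_simp, Real.sqrt_mul (by positivity),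
        Real.sqrt_sq hh.le]
    rw [this, ht]
    field_simp
    ring
  simp only [Finset.sum_apply] at hch
  calc _ ≤ _ := hch
    _ ≤ Real.exp (-t * ((4 * M + 8) * a * (√(h * V) + h * L))) * Real.exp (2 * M * h) := by
        gcongr
    _ = _ := by
        rw [← Real.exp_add, neg_mul, hexp]; ring_nf

/-- **Bernstein's inequality** for weighted sums of independent centred sub-exponential
variables. -/
lemma bernstein [IsProbabilityMeasure μ] {ι : Type*} (s : Finset ι) {Y : ι → Ω → ℝ}
    {a M L V h : ℝ} {lam : ι → ℝ} (hind : iIndepFun Y μ) (hY : ∀ i, HasExpMoment (Y i) a M μ)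
    (h0 : ∀ i, ∫ ω, Y i ω ∂μ = 0) (ha : 0 < a) (hM : 0 ≤ M) (hlam0 : ∀ i ∈ s, 0 ≤ lam i)
    (hlam : ∀ i ∈ s, lam i ≤ L) (hV : ∑ i ∈ s, lam i ^ 2 ≤ V) (hL : 0 < L) (hh : 0 < h) :
    μ.real {ω | (4 * M + 8) * a * (√(h * V) + h * L) ≤ |∑ i ∈ s, lam i * Y i ω|}
      ≤ 2 * Real.exp (-4 * h) := by
  have h1 := one_sided_bernstein s hind hY h0 ha hM hlam0 hlam hV hL hh
  have h2 := one_sided_bernstein s (Y := fun i ω => -Y i ω) (hind.comp (fun _ x => -x)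
    fun i => by fun_prop) (fun i => (hY i).neg) (fun i => by rw [integral_neg, h0, neg_zero])
    ha hM hlam0 hlam hV hL hh
  refine (measureReal_mono (s₂ := {ω | (4 * M + 8) * a * (√(h * V) + h * L) ≤ ∑ i ∈ s, lam i * Y i ω} ∪
    {ω | (4 * M + 8) * a * (√(h * V) + h * L) ≤ ∑ i ∈ s, lam i * -Y i ω}) (fun ω hω => ?_)).trans
    ((measureReal_union_le _ _).trans (by rw [two_mul]; exact add_le_add h1 h2))
  rcases le_abs.1 (Set.mem_ofPred_eq ▸ hω) with h | h
  · exact Or.inl h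
  · right
    simpa [Finset.sum_neg_distrib] using h

end Concentration

/-! ### Squares and products of sub-Gaussian variables -/

section SubGaussian

open scoped NNReal ENNReal

variable {Ω : Type*} [MeasurableSpace Ω] {μ : Measure Ω}

/-- Completing the square in the Gaussian integral. -/
lemma lintegral_exp_mul_sub_sq {c : ℝ} (hc : 0 < c) (w : ℝ) :
    ∫⁻ t : ℝ, ENNReal.ofReal (Real.exp (t * w - c * t ^ 2))
      = ENNReal.ofReal (√(Real.pi / c)) * ENNReal.ofReal (Real.exp (w ^ 2 / (4 * c))) := by
  have h1 : ∀ t : ℝ, Real.exp (t * w - c * t ^ 2)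
      = Real.exp (w ^ 2 / (4 * c)) * Real.exp (-c * (t - w / (2 * c)) ^ 2) := by
    intro t
    rw [← Real.exp_add]
    congr 1
    field_simp
    ring
  simp_rw [h1, ENNReal.ofReal_mul (Real.exp_pos _).le]
  rw [lintegral_const_mul _ (by fun_prop),
    lintegral_sub_right_eq_self (fun t => ENNReal.ofReal (Real.exp (-c * t ^ 2))),
    ← ofReal_integral_eq_lintegral_ofReal (integrable_exp_neg_mul_sq hc)
      (Filter.Eventually.of_forall fun t => (Real.exp_pos _).le), integral_gaussian, mul_comm]

/-- The square of a sub-Gaussian variable is sub-exponential: `exp (w² / (4 c))` is, up to a factor,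
the integral over `t` of `exp (t w - c t²)`. -/
lemma hasExpMoment_sq [IsProbabilityMeasure μ] {W : Ω → ℝ} {c : ℝ≥0} (hc : 0 < c)
    (hW : Measurable W) (h : HasSubgaussianMGF W c μ) :
    HasExpMoment (fun ω => W ω ^ 2) (4 * c) (√2) μ := by
  have hc' : (0 : ℝ) < c := hc
  have hpi := Real.pi_pos
  have key : ENNReal.ofReal (√(Real.pi / c)) *
      ∫⁻ ω, ENNReal.ofReal (Real.exp (W ω ^ 2 / (4 * c))) ∂μ
        ≤ ENNReal.ofReal (√(Real.pi / c)) * ENNReal.ofReal (√2) := by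
    rw [← lintegral_const_mul _ (by fun_prop)]
    simp_rw [← lintegral_exp_mul_sub_sq hc']
    rw [lintegral_lintegral_swap (by fun_prop)]
    calc _ ≤ ∫⁻ t : ℝ, ENNReal.ofReal (Real.exp (-(c / 2) * t ^ 2)) := by
          refine lintegral_mono fun t => ?_
          have h1 : ∀ ω, Real.exp (t * W ω - c * t ^ 2)
              = Real.exp (-(c * t ^ 2)) * Real.exp (t * W ω) := fun ω => by
            rw [← Real.exp_add]; ring_nf
          simp_rw [h1]
          rw [← ofReal_integral_eq_lintegral_ofReal ((h.integrable_exp_mul t).const_mul _)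
            (Filter.Eventually.of_forall fun ω => by positivity), integral_const_mul]
          apply ENNReal.ofReal_le_ofReal
          calc _ ≤ Real.exp (-(c * t ^ 2)) * Real.exp (c * t ^ 2 / 2) := by
                gcongr; exact h.mgf_le t
            _ = _ := by rw [← Real.exp_add]; ring_nf
      _ = _ := by
          rw [← ofReal_integral_eq_lintegral_ofReal (integrable_exp_neg_mul_sq (by positivity))
            (Filter.Eventually.of_forall fun t => (Real.exp_pos _).le), integral_gaussian,
            ← ENNReal.ofReal_mul (by positivity), ← Real.sqrt_mul (by positivity)]
          congr 2
          field_simp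
  have hpos : 0 < √(Real.pi / c) := by positivity
  rw [ENNReal.mul_le_mul_iff_right (by simpa using hpos) (by simp)] at key
  have hint : Integrable (fun ω => Real.exp (W ω ^ 2 / (4 * c))) μ := by
    refine ⟨by fun_prop, ?_⟩
    rw [hasFiniteIntegral_iff_ofReal (Filter.Eventually.of_forall fun ω => (Real.exp_pos _).le)]
    exact key.trans_lt (by simp)
  refine ⟨by fun_prop, by simpa [abs_of_nonneg, sq_nonneg] using hint, ?_⟩
  rw [← ofReal_integral_eq_lintegral_ofReal hint
    (Filter.Eventually.of_forall fun t => (Real.exp_pos _).le),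
    ENNReal.ofReal_le_ofReal_iff (by positivity)] at key
  simpa [abs_of_nonneg, sq_nonneg] using key

namespace HasExpMoment

lemma sub_const {Y : Ω → ℝ} {a M v : ℝ} (h : HasExpMoment Y a M μ) (ha : 0 < a) (hv : 0 ≤ v) :
    HasExpMoment (fun ω => Y ω - v) a (M * Real.exp (v / a)) μ := by
  have hle : ∀ ω, Real.exp (|Y ω - v| / a) ≤ Real.exp (|Y ω| / a) * Real.exp (v / a) := fun ω => by
    rw [← Real.exp_add, ← add_div]
    gcongr
    exact (abs_sub _ _).trans_eq (by rw [abs_of_nonneg hv])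
  have hm := h.measurable
  have hi := h.integrable.mul_const (Real.exp (v / a))
  have hi2 : Integrable (fun ω => Real.exp (|Y ω - v| / a)) μ :=
    hi.mono' (by fun_prop) (Filter.Eventually.of_forall fun ω => by
      rw [Real.norm_eq_abs, abs_of_pos (Real.exp_pos _)]; exact hle ω)
  refine ⟨by fun_prop, hi2, (integral_mono hi2 hi hle).trans ?_⟩
  rw [integral_mul_const]
  gcongr
  exact h.le

lemma mul_of_sq {W Z : Ω → ℝ} {a M : ℝ} (hW : Measurable W) (hZ : Measurable Z)
    (h : HasExpMoment (fun ω => W ω ^ 2) a M μ) (h' : HasExpMoment (fun ω => Z ω ^ 2) a M μ)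
    (ha : 0 < a) :
    HasExpMoment (fun ω => W ω * Z ω) a M μ := by
  have hle : ∀ ω, Real.exp (|W ω * Z ω| / a)
      ≤ (Real.exp (|W ω ^ 2| / a) + Real.exp (|Z ω ^ 2| / a)) / 2 := fun ω => by
    have h1 : |W ω * Z ω| / a ≤ |W ω ^ 2| / a / 2 + |Z ω ^ 2| / a / 2 := by
      rw [abs_mul, abs_pow, abs_pow, ← add_div, ← add_div, div_div, mul_comm a 2, ← div_div]
      gcongr
      nlinarith [sq_nonneg (|W ω| - |Z ω|)]
    have h2 : ∀ x : ℝ, Real.exp x = Real.exp (x / 2) ^ 2 := fun x => by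
      rw [← Real.exp_nat_mul]; congr 1; push_cast; ring
    rw [h2 (|W ω ^ 2| / a), h2 (|Z ω ^ 2| / a)]
    refine (Real.exp_le_exp.2 h1).trans ?_
    rw [Real.exp_add]
    nlinarith [sq_nonneg (Real.exp (|W ω ^ 2| / a / 2) - Real.exp (|Z ω ^ 2| / a / 2))]
  have hi := (h.integrable.add h'.integrable).div_const 2
  have hi2 : Integrable (fun ω => Real.exp (|W ω * Z ω| / a)) μ :=
    hi.mono' (by fun_prop) (Filter.Eventually.of_forall fun ω => by
      rw [Real.norm_eq_abs, abs_of_pos (Real.exp_pos _)]; exact hle ω)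
  refine ⟨by fun_prop, hi2, (integral_mono hi2 hi hle).trans ?_⟩
  simp only [Pi.add_apply]
  rw [integral_div, integral_add h.integrable h'.integrable]
  linarith [h.le, h'.le]

lemma mono {Y : Ω → ℝ} {a M M' : ℝ} (h : HasExpMoment Y a M μ) (hM : M ≤ M') :
    HasExpMoment Y a M' μ := ⟨h.measurable, h.integrable, h.le.trans hM⟩

end HasExpMoment

end SubGaussian

/-! ### Independence of the columns of an array -/

section Independence

variable {Ω : Type*} [MeasurableSpace Ω] {μ : Measure Ω}

/-- If the rows of an array of variables are independent and each row has independent entries, then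
the columns are independent. -/
lemma iIndepFun_columns {ι κ β : Type*} [MeasurableSpace β] {X : ι → κ → Ω → β}
    (hm : ∀ i j, Measurable (X i j)) (h1 : iIndepFun (fun i ω j => X i j ω) μ)
    (h2 : ∀ i, iIndepFun (X i) μ) : iIndepFun (fun j ω i => X i j ω) μ := by
  have := h1.isProbabilityMeasure
  have : ∀ j i, IsProbabilityMeasure (μ.map (X i j)) :=
    fun j i => Measure.isProbabilityMeasure_map (hm i j).aemeasurable
  have hflat : iIndepFun (fun (q : κ × ι) ω => X q.2 q.1 ω) μ :=
    (iIndepFun_uncurry' hm h1 h2).precomp (g := Prod.swap) Prod.swap_injective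
  have hcol : ∀ j, iIndepFun (fun i ω => X i j ω) μ := fun j =>
    (iIndepFun_uncurry' hm h1 h2).precomp (g := fun i => (i, j)) fun a b h => (Prod.mk.inj h).1
  rw [iIndepFun_iff_map_fun_eq_infinitePi_map (by fun_prop)]
  have hcomp : (fun ω j i => X i j ω)
      = (MeasurableEquiv.curry κ ι β) ∘ (fun ω (q : κ × ι) => X q.2 q.1 ω) := rfl
  rw [hcomp, ← Measure.map_map (by fun_prop) (by fun_prop),
    (iIndepFun_iff_map_fun_eq_infinitePi_map (by fun_prop)).1 hflat,
    Measure.infinitePi_map_curry (fun j i => μ.map (X i j))]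
  congr 1
  funext j
  rw [(iIndepFun_iff_map_fun_eq_infinitePi_map (by fun_prop)).1 (hcol j)]

end Independence

/-! ### Nets of the sphere -/

section Net

open Module

variable {E : Type*} [NormedAddCommGroup E] [InnerProductSpace ℝ E] [FiniteDimensional ℝ E]

variable (E) in
/-- The unit sphere of a `d`-dimensional space has a `1/2`-net of at most `5 ^ d` points. -/
lemma exists_net : ∃ N : Finset E, N.card ≤ 5 ^ finrank ℝ E ∧ (∀ x ∈ N, ‖x‖ = 1) ∧
    ∀ x : E, ‖x‖ = 1 → ∃ y ∈ N, ‖x - y‖ ≤ 1 / 2 := by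
  classical
  -- a maximal `1/2`-separated subset of the sphere
  let P : Finset E → Prop := fun N => (∀ x ∈ N, ‖x‖ = 1) ∧
    ∀ x ∈ N, ∀ y ∈ N, x ≠ y → 1 / 2 ≤ ‖x - y‖
  have hcard : ∀ N, P N → N.card ≤ 5 ^ finrank ℝ E := by
    intro N hN
    have h2 : Function.Injective fun x : E => (2 : ℝ) • x :=
      smul_right_injective E (two_ne_zero)
    rw [← Finset.card_image_of_injective N h2]
    apply Besicovitch.card_le_of_separated
    · intro c hc
      obtain ⟨x, hx, rfl⟩ := Finset.mem_image.1 hc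
      simp [norm_smul, hN.1 x hx]
    · intro c hc d hd hcd
      obtain ⟨x, hx, rfl⟩ := Finset.mem_image.1 hc
      obtain ⟨y, hy, rfl⟩ := Finset.mem_image.1 hd
      have := hN.2 x hx y hy (fun h => hcd (by rw [h]))
      rw [← smul_sub, norm_smul, Real.norm_ofNat]
      linarith
  obtain ⟨N, hN, hmax⟩ : ∃ N, P N ∧ ∀ N', P N' → N'.card ≤ N.card := by
    obtain ⟨N, hN, hc⟩ := Nat.findGreatest_spec
      (P := fun m => ∃ N, P N ∧ N.card = m) (Nat.zero_le (5 ^ finrank ℝ E)) ⟨∅, by simp [P], rfl⟩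
    refine ⟨N, hN, fun N' hN' => ?_⟩
    rw [hc]
    exact Nat.le_findGreatest (hcard N' hN') ⟨N', hN', rfl⟩
  refine ⟨N, hcard N hN, hN.1, fun x hx => ?_⟩
  by_contra! hcon
  have hxN : x ∉ N := fun h => by
    have := hcon x h
    norm_num at this
  have := hmax (insert x N) ⟨?_, ?_⟩
  · rw [Finset.card_insert_of_notMem hxN] at this
    omega
  · intro y hy
    rcases Finset.mem_insert.1 hy with rfl | hy
    · exact hx
    · exact hN.1 y hy
  · intro y hy z hz hyz
    rcases Finset.mem_insert.1 hy with rfl | hy' <;> rcases Finset.mem_insert.1 hz with rfl | hz'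
    · exact absurd rfl hyz
    · exact (hcon z hz').le
    · rw [norm_sub_rev]; exact (hcon y hy').le
    · exact hN.2 y hy' z hz' hyz

/-- A linear form is controlled by its values on a `1/2`-net. -/
lemma linear_le_of_net {N : Finset E}
    (hN : ∀ x : E, ‖x‖ = 1 → ∃ y ∈ N, ‖x - y‖ ≤ 1 / 2) (f : E →ₗ[ℝ] ℝ) {τ : ℝ} (hτ : 0 ≤ τ)
    (h : ∀ x ∈ N, |f x| ≤ τ) (x : E) : |f x| ≤ 2 * τ * ‖x‖ := by
  set F := LinearMap.toContinuousLinearMap f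
  have hF : ∀ x, F x = f x := fun x => rfl
  have hnorm : ‖F‖ ≤ τ + ‖F‖ / 2 := by
    refine F.opNorm_le_of_unit_norm (by positivity) fun x hx => ?_
    obtain ⟨y, hy, hxy⟩ := hN x hx
    have h1 : F x = F y + F (x - y) := by rw [map_sub]; ring
    rw [h1]
    calc ‖F y + F (x - y)‖ ≤ ‖F y‖ + ‖F (x - y)‖ := norm_add_le _ _
      _ ≤ τ + ‖F‖ * (1 / 2) := by
          gcongr
          · exact h y hy
          · exact (F.le_opNorm _).trans (by gcongr)
      _ = _ := by ring
  have := F.le_opNorm x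
  rw [hF, Real.norm_eq_abs] at this
  exact this.trans (by gcongr; linarith)

/-- A quadratic form is controlled by its values on a `1/2`-net. If `x`, `y` are unit vectors with
`‖x - y‖ ≤ 1/2`, then `‖x - y‖ ‖x + y‖ ≤ √15 / 4 < 31 / 32`, and polarisation turns
`q x - q y = B (x - y) (x + y)` into values of `q`. -/
lemma quadratic_le_of_net {N : Finset E} (hN1 : ∀ x ∈ N, ‖x‖ = 1)
    (hN : ∀ x : E, ‖x‖ = 1 → ∃ y ∈ N, ‖x - y‖ ≤ 1 / 2) (q : QuadraticForm ℝ E)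
    {τ : ℝ} (hτ : 0 ≤ τ) (h : ∀ x ∈ N, |q x| ≤ τ) (x : E) : |q x| ≤ 32 * τ * ‖x‖ ^ 2 := by
  rcases eq_or_ne x 0 with rfl | hx0
  · simp
  have : Nontrivial E := ⟨x, 0, hx0⟩
  have hcont : Continuous fun x => |q x| := by
    have : ∀ x, q x = (1 / 2 : ℝ) * q.polarBilin x x := fun x => by
      simp [QuadraticMap.polar_self]
    simp_rw [this]
    have hc : Continuous fun x => q.polarBilin x x := by
      let F : E →L[ℝ] E →L[ℝ] ℝ := LinearMap.toContinuousBilinearMap q.polarBilin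
      exact (F.continuous.clm_apply continuous_id : Continuous fun x => F x x)
    fun_prop
  obtain ⟨z, hz, hzmax⟩ := (isCompact_sphere (0 : E) 1).exists_isMaxOn
    (NormedSpace.sphere_nonempty.2 zero_le_one) hcont.continuousOn
  set S := |q z| with hS
  have hz1 : ‖z‖ = 1 := by simpa using hz
  have hsc : ∀ v, |q v| ≤ S * ‖v‖ ^ 2 := by
    intro v
    rcases eq_or_ne v 0 with rfl | hv
    · simp
    have hv' : ‖v‖ ≠ 0 := norm_ne_zero_iff.2 hv
    have h1 : |q (‖v‖⁻¹ • v)| ≤ S := hzmax (by simp [norm_smul, hv'])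
    rw [QuadraticMap.map_smul, smul_eq_mul, abs_mul, abs_mul, abs_inv, abs_norm] at h1
    calc |q v| = (‖v‖⁻¹ * ‖v‖⁻¹ * |q v|) * ‖v‖ ^ 2 := by field_simp
      _ ≤ _ := by gcongr
  suffices hS32 : S ≤ 32 * τ from (hsc x).trans (by gcongr)
  obtain ⟨y, hy, hzy⟩ := hN z hz1
  have hy1 := hN1 y hy
  have hpol : ∀ (t : ℝ), t ≠ 0 → q z - q y = (1 / 4) *
      (q (t • (z - y) + t⁻¹ • (z + y)) - q (t • (z - y) - t⁻¹ • (z + y))) := by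
    intro t ht
    have hsub : ∀ u v : E, q (u + v) - q (u - v) = 2 * QuadraticMap.polar q u v := fun u v => by
      rw [sub_eq_add_neg u v, QuadraticMap.map_add q, QuadraticMap.map_add q,
        QuadraticMap.map_neg, QuadraticMap.polar_neg_right]
      ring
    have hz2 : z = (1 / 2 : ℝ) • ((z - y) + (z + y)) := by module
    have hy2 : y = (1 / 2 : ℝ) • ((z + y) - (z - y)) := by module
    have hzy2 : q z - q y = 1 / 4 * (q ((z + y) + (z - y)) - q ((z + y) - (z - y))) := by
      have e1 : q z = 1 / 4 * q ((z + y) + (z - y)) := by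
        conv_lhs => rw [hz2, QuadraticMap.map_smul, add_comm (z - y)]
        rw [smul_eq_mul]
        ring
      have e2 : q y = 1 / 4 * q ((z + y) - (z - y)) := by
        conv_lhs => rw [hy2, QuadraticMap.map_smul]
        rw [smul_eq_mul]
        ring
      rw [e1, e2]
      ring
    rw [hzy2, hsub, hsub, QuadraticMap.polar_smul_left, QuadraticMap.polar_smul_right,
      QuadraticMap.polar_comm q (z - y), smul_smul, mul_inv_cancel₀ ht, one_smul]
  have hpar := parallelogram_law_with_norm ℝ z y
  rw [hz1, hy1] at hpar
  rcases eq_or_ne z y with hzy0 | hzy0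
  · have := h y hy
    rw [← hzy0] at this
    linarith
  set r := ‖z - y‖ with hr
  set r' := ‖z + y‖ with hr'
  have hrpos : 0 < r := norm_pos_iff.2 (sub_ne_zero.2 hzy0)
  have hr'pos : 0 < r' := by nlinarith [norm_nonneg (z + y)]
  have horth : ⟪z - y, z + y⟫ = 0 := by
    rw [real_inner_comm, inner_add_left, inner_sub_right, inner_sub_right, real_inner_self_eq_norm_sq,
      real_inner_self_eq_norm_sq, real_inner_comm, hz1, hy1]
    ring
  have ht : √(r' / r) ≠ 0 := by positivity
  have hn : ∀ e : ℝ, e = 1 ∨ e = -1 →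
      ‖√(r' / r) • (z - y) + e • (√(r' / r))⁻¹ • (z + y)‖ ^ 2 = 2 * (r * r') := by
    intro e he
    rw [norm_add_sq_real, inner_smul_left, inner_smul_right, inner_smul_right, horth, norm_smul,
      norm_smul, norm_smul, ← hr, ← hr', norm_inv, Real.norm_of_nonneg (Real.sqrt_nonneg _)]
    have he2 : ‖e‖ = 1 := by rcases he with rfl | rfl <;> simp
    rw [he2, mul_pow, Real.sq_sqrt (by positivity), mul_pow, mul_pow, inv_pow,
      Real.sq_sqrt (by positivity)]
    field_simp
    ring
  have h1 := hsc (√(r' / r) • (z - y) + (√(r' / r))⁻¹ • (z + y))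
  have h2 := hsc (√(r' / r) • (z - y) - (√(r' / r))⁻¹ • (z + y))
  have hn1 := hn 1 (Or.inl rfl)
  have hn2 := hn (-1) (Or.inr rfl)
  rw [one_smul] at hn1
  rw [neg_one_smul, ← sub_eq_add_neg] at hn2
  rw [hn1] at h1
  rw [hn2] at h2
  have h3 := hpol _ ht
  have hrr : r * r' ≤ 31 / 32 := by
    refine le_of_sq_le_sq ?_ (by norm_num)
    have hr2 : r ^ 2 ≤ 1 / 4 := by nlinarith
    rw [mul_pow, show r' ^ 2 = 4 - r ^ 2 by linarith]
    nlinarith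
  have hS0 : 0 ≤ S := abs_nonneg _
  have h4 : |q z - q y| ≤ S * (31 / 32) := by
    rw [h3, abs_mul]
    calc _ ≤ |(1 / 4 : ℝ)| * (S * (2 * (r * r')) + S * (2 * (r * r'))) := by
          gcongr
          exact (abs_sub _ _).trans (add_le_add h1 h2)
      _ = S * (r * r') := by rw [abs_of_pos (by norm_num)]; ring
      _ ≤ _ := by gcongr
  have h5 := h y hy
  have h6 : S ≤ |q z - q y| + |q y| := by
    calc S = |(q z - q y) + q y| := by rw [sub_add_cancel]
      _ ≤ _ := abs_add_le _ _
  linarith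

end Net

/-! ### The whitened features and the noise -/

section Model

open scoped NNReal

/-- The coordinates of `u = Σ^{-1/2} x`, as functions of the pair `(x, y)`. -/
def whitened {p : ℕ} (lam : Fin p → ℝ) (i : Fin p) (z : EuclideanSpace ℝ (Fin p) × ℝ) : ℝ :=
  (√(lam i))⁻¹ * z.1 i

/-- The noise `y - xᵀ θ⋆`, as a function of the pair `(x, y)`. -/
def residual {p : ℕ} (θs : EuclideanSpace ℝ (Fin p)) (z : EuclideanSpace ℝ (Fin p) × ℝ) : ℝ :=
  z.2 - ⟪z.1, θs⟫

/-- The one-dimensional marginal `φᵀ u`. -/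
def marginal {p : ℕ} (lam : Fin p → ℝ) (φ : EuclideanSpace ℝ (Fin p))
    (z : EuclideanSpace ℝ (Fin p) × ℝ) : ℝ :=
  ∑ i, φ i * whitened lam i z

lemma measurable_whitened {p : ℕ} (lam : Fin p → ℝ) (i : Fin p) :
    Measurable (whitened lam i) := by
  unfold whitened; fun_prop

lemma measurable_residual {p : ℕ} (θs : EuclideanSpace ℝ (Fin p)) :
    Measurable (residual θs) := by
  unfold residual; fun_prop

lemma measurable_marginal {p : ℕ} (lam : Fin p → ℝ) (φ : EuclideanSpace ℝ (Fin p)) :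
    Measurable (marginal lam φ) :=
  Finset.measurable_sum _ fun i _ => (measurable_whitened lam i).const_mul _

lemma hasSubgaussianMGF_mono {Ω : Type*} [MeasurableSpace Ω] {μ : Measure Ω} {X : Ω → ℝ}
    {c c' : ℝ≥0} (h : HasSubgaussianMGF X c μ) (hc : c ≤ c') : HasSubgaussianMGF X c' μ :=
  ⟨h.integrable_exp_mul, fun t => (h.mgf_le t).trans (by gcongr)⟩

variable {Ω : Type*} [MeasurableSpace Ω] {μ : Measure Ω} [IsProbabilityMeasure μ] {n p : ℕ}
  {ν : Measure (EuclideanSpace ℝ (Fin p) × ℝ)} [IsProbabilityMeasure ν]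
  {xs : Fin n → Ω → EuclideanSpace ℝ (Fin p)} {ys : Fin n → Ω → ℝ}
  {lam : Fin p → ℝ} {θs : EuclideanSpace ℝ (Fin p)} {σx σy σ κ : ℝ}

namespace DataAssumptions

variable (H : DataAssumptions μ ν xs ys lam θs σx σy σ κ)
include H

lemma subgaussian_marginal (φ : EuclideanSpace ℝ (Fin p)) :
    HasSubgaussianMGF (marginal lam φ) (Real.toNNReal (σx ^ 2 * ‖φ‖ ^ 2)) ν := by
  have hc : ((Real.toNNReal (σx ^ 2 * ‖φ‖ ^ 2) : ℝ≥0) : ℝ) = σx ^ 2 * ‖φ‖ ^ 2 :=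
    Real.coe_toNNReal _ (by positivity)
  have he : ∀ t z, Real.exp (t * marginal lam φ z)
      = Real.exp (∑ i, (t • φ) i * ((√(lam i))⁻¹ * z.1 i)) := fun t z => by
    simp [marginal, whitened, Finset.mul_sum, mul_assoc]
  refine ⟨fun t => ?_, fun t => ?_⟩
  · simp_rw [he]; exact H.subgaussian_u_integrable _
  · rw [mgf, hc]
    simp_rw [he]
    refine (H.subgaussian_u _).trans_eq ?_
    rw [norm_smul, mul_pow, Real.norm_eq_abs, sq_abs]
    ring_nf

lemma subgaussian_whitened (i : Fin p) :
    HasSubgaussianMGF (whitened lam i) (Real.toNNReal (σx ^ 2)) ν := by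
  have := H.subgaussian_marginal (EuclideanSpace.single i 1)
  have h1 : marginal lam (EuclideanSpace.single i 1) = whitened lam i := by
    funext z
    simp [marginal]
  simpa [h1] using this

lemma subgaussian_residual : HasSubgaussianMGF (residual θs) (Real.toNNReal (σy ^ 2)) ν := by
  have hc : ((Real.toNNReal (σy ^ 2) : ℝ≥0) : ℝ) = σy ^ 2 := Real.coe_toNNReal _ (by positivity)
  refine ⟨fun t => H.subgaussian_noise_integrable t, fun t => ?_⟩
  rw [hc, mgf]
  have h1 := integral_condExp (μ := ν)
    (m := MeasurableSpace.comap (Prod.fst : EuclideanSpace ℝ (Fin p) × ℝ → _) inferInstance)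
    (measurable_fst.comap_le) (f := fun z => Real.exp (t * (z.2 - ⟪z.1, θs⟫)))
  change ∫ z, Real.exp (t * (z.2 - ⟪z.1, θs⟫)) ∂ν ≤ _
  rw [← h1]
  calc _ ≤ ∫ _z, Real.exp (σy ^ 2 * t ^ 2 / 2) ∂ν :=
        integral_mono_ae integrable_condExp (integrable_const _) (H.subgaussian_noise t)
    _ = _ := by simp

lemma integral_residual_sq : ∫ z, residual θs z ^ 2 ∂ν = σ ^ 2 := by
  have h1 := integral_condExp (μ := ν)
    (m := MeasurableSpace.comap (Prod.fst : EuclideanSpace ℝ (Fin p) × ℝ → _) inferInstance)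
    (measurable_fst.comap_le) (f := fun z => (z.2 - ⟪z.1, θs⟫) ^ 2)
  change ∫ z, (z.2 - ⟪z.1, θs⟫) ^ 2 ∂ν = _
  rw [← h1, integral_congr_ae H.variance_noise]
  simp

lemma memLp_whitened (i : Fin p) : MemLp (whitened lam i) 2 ν := by
  simpa using (H.subgaussian_whitened i).memLp 2

lemma memLp_residual : MemLp (residual θs) 2 ν := by
  simpa using H.subgaussian_residual.memLp 2

lemma integral_whitened (i : Fin p) : ∫ z, whitened lam i z ∂ν = 0 := by
  simp_rw [whitened]
  rw [integral_const_mul, H.mean_x, mul_zero]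

lemma integral_whitened_mul (i j : Fin p) :
    ∫ z, whitened lam i z * whitened lam j z ∂ν = if i = j then 1 else 0 := by
  have h1 : ∀ z, whitened lam i z * whitened lam j z
      = ((√(lam i))⁻¹ * (√(lam j))⁻¹) * (z.1 i * z.1 j) := fun z => by
    simp only [whitened]; ring
  simp_rw [h1]
  rw [integral_const_mul, H.covariance, Matrix.diagonal_apply]
  split_ifs with hij
  · subst hij
    have := H.lam_pos i
    rw [← mul_inv, Real.mul_self_sqrt this.le, inv_mul_cancel₀ this.ne']
  · simp

lemma integral_marginal_sq (φ : EuclideanSpace ℝ (Fin p)) :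
    ∫ z, marginal lam φ z ^ 2 ∂ν = ‖φ‖ ^ 2 := by
  have h1 : ∀ z, marginal lam φ z ^ 2
      = ∑ i, ∑ j, (φ i * φ j) * (whitened lam i z * whitened lam j z) := fun z => by
    rw [marginal, sq, Finset.sum_mul_sum]
    exact Finset.sum_congr rfl fun i _ => Finset.sum_congr rfl fun j _ => by ring
  have hi : ∀ i j, Integrable (fun z => (φ i * φ j) * (whitened lam i z * whitened lam j z)) ν :=
    fun i j => ((H.memLp_whitened i).integrable_mul (H.memLp_whitened j)).const_mul _
  simp_rw [h1]
  rw [integral_finsetSum _ fun i _ => integrable_finsetSum _ fun j _ => hi i j]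
  simp_rw [integral_finsetSum _ fun j _ => hi _ j, integral_const_mul, H.integral_whitened_mul]
  rw [EuclideanSpace.norm_sq_eq]
  simp [sq]

/-- The normal equations: the noise of an optimal regressor is uncorrelated with the features. -/
lemma integral_residual_mul_whitened (i : Fin p) :
    ∫ z, residual θs z * whitened lam i z ∂ν = 0 := by
  set B := ∫ z, residual θs z * whitened lam i z ∂ν with hB
  have hi1 : Integrable (fun z => residual θs z ^ 2) ν := H.memLp_residual.integrable_sq
  have hi2 : Integrable (fun z => residual θs z * whitened lam i z) ν :=
    H.memLp_residual.integrable_mul (H.memLp_whitened i)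
  have hi3 : Integrable (fun z => whitened lam i z * whitened lam i z) ν :=
    (H.memLp_whitened i).integrable_mul (H.memLp_whitened i)
  have key : ∀ t : ℝ, 0 ≤ -2 * t * B + t ^ 2 := by
    intro t
    have h1 := H.optimal (θs + EuclideanSpace.single i (t * (√(lam i))⁻¹))
    have h2 : ∀ z : EuclideanSpace ℝ (Fin p) × ℝ,
        (z.2 - ⟪z.1, θs + EuclideanSpace.single i (t * (√(lam i))⁻¹)⟫) ^ 2
          = residual θs z ^ 2 + (-2 * t * (residual θs z * whitened lam i z)
            + t ^ 2 * (whitened lam i z * whitened lam i z)) := fun z => by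
      rw [inner_add_right, EuclideanSpace.inner_single_right]
      simp only [residual, whitened, conj_trivial]
      ring
    simp_rw [h2] at h1
    have h3 : Integrable (fun z => -2 * t * (residual θs z * whitened lam i z)
        + t ^ 2 * (whitened lam i z * whitened lam i z)) ν :=
      (hi2.const_mul _).add (hi3.const_mul _)
    rw [integral_add hi1 h3,
      integral_add (hi2.const_mul _) (hi3.const_mul _), integral_const_mul, integral_const_mul,
      H.integral_whitened_mul, if_pos rfl] at h1
    change ∫ z, residual θs z ^ 2 ∂ν ≤ _ at h1
    linarith
  have := key B
  nlinarith

lemma integral_marginal_mul_residual (φ : EuclideanSpace ℝ (Fin p)) :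
    ∫ z, marginal lam φ z * residual θs z ∂ν = 0 := by
  have h1 : ∀ z, marginal lam φ z * residual θs z
      = ∑ i, φ i * (residual θs z * whitened lam i z) := fun z => by
    rw [marginal, Finset.sum_mul]
    exact Finset.sum_congr rfl fun i _ => by ring
  have hi : ∀ i, Integrable (fun z => φ i * (residual θs z * whitened lam i z)) ν := fun i =>
    (H.memLp_residual.integrable_mul (H.memLp_whitened i)).const_mul (φ i)
  simp_rw [h1]
  rw [integral_finsetSum _ fun i _ => hi i]
  simp_rw [integral_const_mul]
  refine Finset.sum_eq_zero fun i _ => ?_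
  rw [show ∫ z, residual θs z * whitened lam i z ∂ν = 0 from H.integral_residual_mul_whitened i,
    mul_zero]

/-! ### Transfer to the sample -/

lemma measurable_sample (l : Fin n) : Measurable fun ω => (xs l ω, ys l ω) :=
  (H.measurable_xs l).prodMk (H.measurable_ys l)

lemma integral_sample (l : Fin n) {f : EuclideanSpace ℝ (Fin p) × ℝ → ℝ} (hf : Measurable f) :
    ∫ ω, f (xs l ω, ys l ω) ∂μ = ∫ z, f z ∂ν := by
  rw [← H.law l, integral_map (H.measurable_sample l).aemeasurable hf.aestronglyMeasurable]

lemma hasExpMoment_sample (l : Fin n) {f : EuclideanSpace ℝ (Fin p) × ℝ → ℝ} {a M : ℝ}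
    (hf : HasExpMoment f a M ν) : HasExpMoment (fun ω => f (xs l ω, ys l ω)) a M μ := by
  have hm : Measurable fun z => Real.exp (|f z| / a) := by
    have := hf.measurable
    fun_prop
  refine ⟨hf.measurable.comp (H.measurable_sample l), ?_, ?_⟩
  · have := hf.integrable
    rw [← H.law l] at this
    exact this.comp_measurable (H.measurable_sample l)
  · rw [H.integral_sample l hm]
    exact hf.le

lemma subgaussian_sample (l : Fin n) {f : EuclideanSpace ℝ (Fin p) × ℝ → ℝ} {c : ℝ≥0}
    (hf : HasSubgaussianMGF f c ν) : HasSubgaussianMGF (fun ω => f (xs l ω, ys l ω)) c μ := by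
  rw [← H.law l] at hf
  exact HasSubgaussianMGF.of_map (H.measurable_sample l).aemeasurable hf

lemma iIndepFun_sample {β : Type*} [MeasurableSpace β] {f : EuclideanSpace ℝ (Fin p) × ℝ → β}
    (hf : Measurable f) : iIndepFun (fun l ω => f (xs l ω, ys l ω)) μ :=
  H.indep.comp (fun _ => f) fun _ => hf

/-- The coordinate vectors `(u_{1,i}, …, u_{n,i})`, for `i = 1, …, p`, are independent. -/
lemma iIndepFun_whitened_columns :
    iIndepFun (fun (i : Fin p) ω (l : Fin n) => whitened lam i (xs l ω, ys l ω)) μ := by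
  refine iIndepFun_columns (X := fun l i ω => whitened lam i (xs l ω, ys l ω))
    (fun l i => (measurable_whitened lam i).comp (H.measurable_sample l)) ?_ fun l => ?_
  · exact H.iIndepFun_sample (f := fun z i => whitened lam i z)
      (measurable_pi_lambda _ fun i => measurable_whitened lam i)
  · have h1 : iIndepFun (fun i => whitened lam i) ν := H.indep_u
    rw [← H.law l] at h1
    have : IsProbabilityMeasure (μ.map fun ω => (xs l ω, ys l ω)) :=
      Measure.isProbabilityMeasure_map (H.measurable_sample l).aemeasurable
    rw [iIndepFun_iff_map_fun_eq_pi_map fun i => (measurable_whitened lam i).aemeasurable,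
      Measure.map_map (measurable_pi_lambda _ fun i => measurable_whitened lam i)
        (H.measurable_sample l)] at h1
    simp_rw [Measure.map_map (measurable_whitened lam _) (H.measurable_sample l)] at h1
    exact (iIndepFun_iff_map_fun_eq_pi_map fun i =>
      ((measurable_whitened lam i).comp (H.measurable_sample l)).aemeasurable).2 h1

lemma subgaussian_column (φ : EuclideanSpace ℝ (Fin n)) (i : Fin p) :
    HasSubgaussianMGF (fun ω => ∑ l, φ l * whitened lam i (xs l ω, ys l ω))
      (Real.toNNReal (σx ^ 2 * ‖φ‖ ^ 2)) μ := by
  have hl : ∀ l, HasSubgaussianMGF (fun ω => φ l * whitened lam i (xs l ω, ys l ω))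
      (Real.toNNReal (σx ^ 2 * φ l ^ 2)) μ := fun l => by
    refine hasSubgaussianMGF_mono
      ((H.subgaussian_sample l (H.subgaussian_whitened i)).const_mul (φ l)) ?_
    rw [← NNReal.coe_le_coe, Real.coe_toNNReal _ (by positivity)]
    change φ l ^ 2 * ((Real.toNNReal (σx ^ 2) : ℝ≥0) : ℝ) ≤ _
    rw [Real.coe_toNNReal _ (by positivity), mul_comm]
  have h := HasSubgaussianMGF.sum_of_iIndepFun (s := Finset.univ)
    ((H.iIndepFun_sample (measurable_whitened lam i)).comp (fun l x => φ l * x)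
      fun l => by fun_prop) (fun l _ => hl l)
  refine hasSubgaussianMGF_mono h (le_of_eq ?_)
  rw [← Real.toNNReal_sum_of_nonneg fun l _ => by positivity, EuclideanSpace.norm_sq_eq,
    Finset.mul_sum]
  simp

lemma integral_column_sq (φ : EuclideanSpace ℝ (Fin n)) (i : Fin p) :
    ∫ ω, (∑ l, φ l * whitened lam i (xs l ω, ys l ω)) ^ 2 ∂μ = ‖φ‖ ^ 2 := by
  have hind := (H.iIndepFun_sample (measurable_whitened lam i))
  have hm : ∀ l, MemLp (fun ω => whitened lam i (xs l ω, ys l ω)) 2 μ := fun l => by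
    simpa using (H.subgaussian_sample l (H.subgaussian_whitened i)).memLp 2
  have hmean : ∀ l, ∫ ω, whitened lam i (xs l ω, ys l ω) ∂μ = 0 := fun l => by
    rw [H.integral_sample l (measurable_whitened lam i), H.integral_whitened]
  have h1 : ∀ ω, (∑ l, φ l * whitened lam i (xs l ω, ys l ω)) ^ 2
      = ∑ l, ∑ m, (φ l * φ m) *
        (whitened lam i (xs l ω, ys l ω) * whitened lam i (xs m ω, ys m ω)) := fun ω => by
    rw [sq, Finset.sum_mul_sum]
    exact Finset.sum_congr rfl fun i _ => Finset.sum_congr rfl fun j _ => by ring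
  have hi : ∀ l m, Integrable (fun ω => (φ l * φ m) *
      (whitened lam i (xs l ω, ys l ω) * whitened lam i (xs m ω, ys m ω))) μ :=
    fun l m => ((hm l).integrable_mul (hm m)).const_mul _
  have hcov : ∀ l m, ∫ ω, whitened lam i (xs l ω, ys l ω) * whitened lam i (xs m ω, ys m ω) ∂μ
      = if l = m then 1 else 0 := by
    intro l m
    split_ifs with hlm
    · subst hlm
      rw [H.integral_sample l (f := fun z => whitened lam i z * whitened lam i z)
        ((measurable_whitened lam i).mul (measurable_whitened lam i)), H.integral_whitened_mul,
        if_pos rfl]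
    · rw [(hind.indepFun hlm).integral_fun_mul_eq_mul_integral (hm l).aestronglyMeasurable
        (hm m).aestronglyMeasurable, hmean, zero_mul]
  simp_rw [h1]
  rw [integral_finsetSum _ fun i _ => integrable_finsetSum _ fun j _ => hi i j]
  simp_rw [integral_finsetSum _ fun j _ => hi _ j, integral_const_mul, hcov]
  rw [EuclideanSpace.norm_sq_eq]
  simp [sq]

end DataAssumptions

end Model

/-! ### Uniform concentration -/

section Uniform

open Module

variable {Ω : Type*} [MeasurableSpace Ω] {μ : Measure Ω} [IsProbabilityMeasure μ]

section Union

variable {E : Type*} [NormedAddCommGroup E] [InnerProductSpace ℝ E] [FiniteDimensional ℝ E]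

lemma measureReal_exists_mem_le {N : Finset E} {m : ℕ} (hN : N.card ≤ m)
    {g : Ω → E → ℝ} {τ π : ℝ} (hπ : 0 ≤ π) (h : ∀ x ∈ N, μ.real {ω | τ ≤ |g ω x|} ≤ π) :
    μ.real {ω | ∃ x ∈ N, τ ≤ |g ω x|} ≤ m * π := by
  have h1 : {ω | ∃ x ∈ N, τ ≤ |g ω x|} = ⋃ x ∈ N, {ω | τ ≤ |g ω x|} := by
    ext ω; simp
  rw [h1]
  calc _ ≤ ∑ x ∈ N, μ.real {ω | τ ≤ |g ω x|} := measureReal_biUnion_finset_le _ _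
    _ ≤ ∑ _x ∈ N, π := Finset.sum_le_sum h
    _ = N.card * π := by simp
    _ ≤ m * π := by gcongr

/-- A tail bound for a random quadratic form at each unit vector yields a uniform one, at the cost
of a factor `5 ^ d`. -/
lemma uniform_quadratic (q : Ω → QuadraticForm ℝ E) {τ π : ℝ} (hτ : 0 ≤ τ) (hπ : 0 ≤ π)
    (h : ∀ x, ‖x‖ = 1 → μ.real {ω | τ ≤ |q ω x|} ≤ π) :
    μ.real {ω | ¬ ∀ x, |q ω x| ≤ 32 * τ * ‖x‖ ^ 2} ≤ 5 ^ finrank ℝ E * π := by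
  obtain ⟨N, hN, hN1, hNnet⟩ := exists_net E
  refine (measureReal_mono (fun ω hω => ?_)).trans
    ((measureReal_exists_mem_le hN (g := fun ω x => q ω x) hπ fun x hx => h x (hN1 x hx)).trans_eq
      (by push_cast; rfl))
  by_contra hcon
  simp only [Set.mem_ofPred_eq, not_exists, not_and, not_le] at hcon
  exact hω (quadratic_le_of_net hN1 hNnet (q ω) hτ fun x hx => (hcon x hx).le)

/-- A tail bound for a random linear form at each unit vector yields a uniform one, at the cost
of a factor `5 ^ d`. -/
lemma uniform_linear (f : Ω → E →ₗ[ℝ] ℝ) {τ π : ℝ} (hτ : 0 ≤ τ) (hπ : 0 ≤ π)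
    (h : ∀ x, ‖x‖ = 1 → μ.real {ω | τ ≤ |f ω x|} ≤ π) :
    μ.real {ω | ¬ ∀ x, |f ω x| ≤ 2 * τ * ‖x‖} ≤ 5 ^ finrank ℝ E * π := by
  obtain ⟨N, hN, hN1, hNnet⟩ := exists_net E
  refine (measureReal_mono (fun ω hω => ?_)).trans
    ((measureReal_exists_mem_le hN (g := fun ω x => f ω x) hπ fun x hx => h x (hN1 x hx)).trans_eq
      (by push_cast; rfl))
  by_contra hcon
  simp only [Set.mem_ofPred_eq, not_exists, not_and, not_le] at hcon
  exact hω (linear_le_of_net hNnet (f ω) hτ fun x hx => (hcon x hx).le)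

end Union

/-- The scale at which squares of the whitened features and of the noise are sub-exponential. -/
def expScale (σx σy : ℝ) : ℝ := 4 * (σx ^ 2 + σy ^ 2)

/-- A bound for the exponential moments, at scale `expScale`, of all variables that occur. -/
def expBound (σx σy σ : ℝ) : ℝ := √2 * Real.exp ((1 + σ ^ 2) / expScale σx σy)

/-- The constant in Bernstein's inequality for the features and the noise. -/
def devConst (σx σy σ : ℝ) : ℝ := (4 * expBound σx σy σ + 8) * expScale σx σy

section

variable {σx σy σ : ℝ}

lemma expScale_pos (hσx : 0 < σx) : 0 < expScale σx σy := by unfold expScale; positivity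

lemma expBound_nonneg : 0 ≤ expBound σx σy σ := by unfold expBound; positivity

lemma devConst_pos (hσx : 0 < σx) : 0 < devConst σx σy σ := by
  have := expScale_pos (σy := σy) hσx
  have := expBound_nonneg (σx := σx) (σy := σy) (σ := σ)
  unfold devConst; positivity

lemma hasExpMoment_sq_of_le (hσx : 0 < σx) {W : Ω → ℝ} (hW : Measurable W) {r : ℝ}
    (hr : r ≤ σx ^ 2 + σy ^ 2) (h : HasSubgaussianMGF W (Real.toNNReal r) μ) :
    HasExpMoment (fun ω => W ω ^ 2) (expScale σx σy) (√2) μ := by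
  have hp : 0 < σx ^ 2 + σy ^ 2 := by positivity
  have := hasExpMoment_sq (Real.toNNReal_pos.2 hp) hW
    (hasSubgaussianMGF_mono h (Real.toNNReal_le_toNNReal hr))
  rwa [Real.coe_toNNReal _ hp.le] at this

lemma hasExpMoment_sq_sub (hσx : 0 < σx) {W : Ω → ℝ} (hW : Measurable W) {r : ℝ}
    (hr : r ≤ σx ^ 2 + σy ^ 2) (h : HasSubgaussianMGF W (Real.toNNReal r) μ) {v : ℝ}
    (hv : 0 ≤ v) (hv' : v ≤ 1 + σ ^ 2) :
    HasExpMoment (fun ω => W ω ^ 2 - v) (expScale σx σy) (expBound σx σy σ) μ := by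
  have ha := expScale_pos (σy := σy) hσx
  refine ((hasExpMoment_sq_of_le hσx hW hr h).sub_const ha hv).mono ?_
  unfold expBound
  gcongr

end

open scoped NNReal

variable {n p : ℕ}
  {ν : Measure (EuclideanSpace ℝ (Fin p) × ℝ)} [IsProbabilityMeasure ν]
  {xs : Fin n → Ω → EuclideanSpace ℝ (Fin p)} {ys : Fin n → Ω → ℝ}
  {lam : Fin p → ℝ} {θs : EuclideanSpace ℝ (Fin p)} {σx σy σ κ : ℝ}

namespace DataAssumptions

variable (H : DataAssumptions μ ν xs ys lam θs σx σy σ κ) (hσx : 0 < σx)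
include H hσx

/-- Bernstein's inequality for a sum over the sample. -/
lemma sample_bernstein {f : EuclideanSpace ℝ (Fin p) × ℝ → ℝ}
    (hf : HasExpMoment f (expScale σx σy) (expBound σx σy σ) ν) (h0 : ∫ z, f z ∂ν = 0) {h : ℝ}
    (hh : 0 < h) :
    μ.real {ω | devConst σx σy σ * (√(h * n) + h) ≤ |∑ l, f (xs l ω, ys l ω)|}
      ≤ 2 * Real.exp (-4 * h) := by
  have := bernstein (μ := μ) Finset.univ (Y := fun l ω => f (xs l ω, ys l ω)) (lam := fun _ => 1)
    (L := 1) (V := n) (h := h) (H.iIndepFun_sample hf.measurable)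
    (fun l => H.hasExpMoment_sample l hf)
    (fun l => by rw [H.integral_sample l hf.measurable, h0]) (expScale_pos hσx) expBound_nonneg
    (by simp) (by simp) (by simp) one_pos hh
  simpa [devConst] using this

/-- Bernstein's inequality for `φᵀ (∑_i λ_i z_i z_iᵀ) φ`, where the `z_i` are the columns of the
whitened data matrix. -/
lemma column_bernstein {φ : EuclideanSpace ℝ (Fin n)} (hφ : ‖φ‖ = 1) (s : Finset (Fin p))
    {L V h : ℝ} (hlam : ∀ i ∈ s, lam i ≤ L) (hV : ∑ i ∈ s, lam i ^ 2 ≤ V) (hL : 0 < L)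
    (hh : 0 < h) :
    μ.real {ω | devConst σx σy σ * (√(h * V) + h * L) ≤
        |∑ i ∈ s, lam i * ((∑ l, φ l * whitened lam i (xs l ω, ys l ω)) ^ 2 - 1)|}
      ≤ 2 * Real.exp (-4 * h) := by
  have hm : ∀ i, Measurable fun ω => ∑ l, φ l * whitened lam i (xs l ω, ys l ω) := fun i =>
    Finset.measurable_sum _ fun l _ =>
      ((measurable_whitened lam i).comp (H.measurable_sample l)).const_mul _
  have hY : ∀ i, HasExpMoment
      (fun ω => (∑ l, φ l * whitened lam i (xs l ω, ys l ω)) ^ 2 - 1)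
      (expScale σx σy) (expBound σx σy σ) μ := fun i =>
    hasExpMoment_sq_sub hσx (hm i) (r := σx ^ 2 * ‖φ‖ ^ 2)
      (by rw [hφ]; nlinarith [sq_nonneg σy]) (H.subgaussian_column φ i) zero_le_one
      (by nlinarith [sq_nonneg σ])
  refine bernstein (μ := μ) s (H.iIndepFun_whitened_columns.comp
    (fun _ x => (∑ l, φ l * x l) ^ 2 - 1) fun _ => by fun_prop) hY (fun i => ?_)
    (expScale_pos hσx) expBound_nonneg (fun i _ => (H.lam_pos i).le) hlam hV hL hh
  have hm2 : Integrable (fun ω => (∑ l, φ l * whitened lam i (xs l ω, ys l ω)) ^ 2) μ :=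
    MemLp.integrable_sq (by simpa using (H.subgaussian_column φ i).memLp 2)
  have := H.integral_column_sq φ i
  change ∫ ω, ((∑ l, φ l * whitened lam i (xs l ω, ys l ω)) ^ 2 - 1) ∂μ = 0
  rw [integral_sub hm2 (integrable_const _), this, hφ]
  simp

/-- The Gram matrix `∑_{i ∈ s} λ_i z_i z_iᵀ` of the features in `s` is close to a multiple of the
identity. -/
lemma gram_concentration (s : Finset (Fin p)) {L V : ℝ} (hlam : ∀ i ∈ s, lam i ≤ L)
    (hV : ∑ i ∈ s, lam i ^ 2 ≤ V) (hL : 0 < L) (hn : 0 < n) :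
    μ.real {ω | ¬ ∀ v : EuclideanSpace ℝ (Fin n),
        |∑ i ∈ s, lam i * (∑ l, v l * whitened lam i (xs l ω, ys l ω)) ^ 2
            - (∑ i ∈ s, lam i) * ‖v‖ ^ 2|
          ≤ 32 * (devConst σx σy σ * (√(n * V) + n * L)) * ‖v‖ ^ 2}
      ≤ 5 ^ n * (2 * Real.exp (-4 * n)) := by
  let f : Ω → Fin p → EuclideanSpace ℝ (Fin n) →ₗ[ℝ] ℝ := fun ω i =>
    IsLinearMap.mk' (fun v => ∑ l, v l * whitened lam i (xs l ω, ys l ω))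
      ⟨fun v w => by simp [add_mul, Finset.sum_add_distrib],
        fun c v => by simp [Finset.mul_sum, mul_assoc]⟩
  let q : Ω → QuadraticForm ℝ (EuclideanSpace ℝ (Fin n)) := fun ω =>
    ∑ i ∈ s, lam i • QuadraticMap.linMulLin (f ω i) (f ω i)
      - (∑ i ∈ s, lam i) • LinearMap.BilinMap.toQuadraticMap (innerₗ _)
  have hq : ∀ ω v, q ω v = ∑ i ∈ s, lam i * (∑ l, v l * whitened lam i (xs l ω, ys l ω)) ^ 2
            - (∑ i ∈ s, lam i) * ‖v‖ ^ 2 := fun ω v => by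
    simp [q, f, sq]
  have hK := devConst_pos (σy := σy) (σ := σ) hσx
  have hn' : (0 : ℝ) < n := by exact_mod_cast hn
  have := uniform_quadratic (μ := μ) q
    (τ := devConst σx σy σ * (√(n * V) + n * L)) (π := 2 * Real.exp (-4 * n)) (by positivity)
    (by positivity) fun v hv => by
      convert! H.column_bernstein hσx hv s hlam hV hL hn' using 6 with ω
      rw [hq, hv, Finset.sum_mul, ← Finset.sum_sub_distrib]
      exact Finset.sum_congr rfl fun i _ => by ring
  simp_rw [hq] at this
  simpa using this

/-- The empirical covariance of the whitened features is close to the identity on a subspace. -/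
lemma covariance_concentration (S : Submodule ℝ (EuclideanSpace ℝ (Fin p))) {h : ℝ}
    (hh : 0 < h) :
    μ.real {ω | ¬ ∀ φ ∈ S, |∑ l, marginal lam φ (xs l ω, ys l ω) ^ 2 - n * ‖φ‖ ^ 2|
          ≤ 32 * (devConst σx σy σ * (√(h * n) + h)) * ‖φ‖ ^ 2}
      ≤ 5 ^ finrank ℝ S * (2 * Real.exp (-4 * h)) := by
  let f : Ω → Fin n → S →ₗ[ℝ] ℝ := fun ω l =>
    IsLinearMap.mk' (fun φ : S => marginal lam φ (xs l ω, ys l ω))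
      ⟨fun v w => by simp [marginal, add_mul, Finset.sum_add_distrib],
        fun c v => by simp [marginal, Finset.mul_sum, mul_assoc]⟩
  let q : Ω → QuadraticForm ℝ S := fun ω =>
    ∑ l, QuadraticMap.linMulLin (f ω l) (f ω l)
      - (n : ℝ) • LinearMap.BilinMap.toQuadraticMap (innerₗ _)
  have hq : ∀ ω (φ : S), q ω φ = ∑ l, marginal lam φ (xs l ω, ys l ω) ^ 2
      - n * ‖(φ : EuclideanSpace ℝ (Fin p))‖ ^ 2 := fun ω v => by
    simp [q, f, sq]
  have hK := devConst_pos (σy := σy) (σ := σ) hσx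
  have := uniform_quadratic (μ := μ) q
    (τ := devConst σx σy σ * (√(h * n) + h)) (π := 2 * Real.exp (-4 * h)) (by positivity)
    (by positivity) fun φ hφ => by
      have hφ' : ‖(φ : EuclideanSpace ℝ (Fin p))‖ = 1 := hφ
      have hE := hasExpMoment_sq_sub (σy := σy) (σ := σ) hσx
        (measurable_marginal lam (φ : EuclideanSpace ℝ (Fin p)))
        (by rw [hφ']; nlinarith [sq_nonneg σy])
        (H.subgaussian_marginal φ) zero_le_one (by nlinarith [sq_nonneg σ])
      have hi : Integrable (fun z => marginal lam (φ : EuclideanSpace ℝ (Fin p)) z ^ 2) ν :=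
        MemLp.integrable_sq (by simpa using (H.subgaussian_marginal φ).memLp 2)
      convert! H.sample_bernstein hσx hE (by
        rw [integral_sub hi (integrable_const _), H.integral_marginal_sq, hφ']; simp)
        hh using 5 with ω
      rw [hq, hφ']
      simp
  simp_rw [hq] at this
  simpa using this

/-- The noise is almost uncorrelated with the features on a subspace. -/
lemma cross_concentration (S : Submodule ℝ (EuclideanSpace ℝ (Fin p))) {h : ℝ} (hh : 0 < h) :
    μ.real {ω | ¬ ∀ φ ∈ S,
        |∑ l, marginal lam φ (xs l ω, ys l ω) * residual θs (xs l ω, ys l ω)|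
          ≤ 2 * (devConst σx σy σ * (√(h * n) + h)) * ‖φ‖}
      ≤ 5 ^ finrank ℝ S * (2 * Real.exp (-4 * h)) := by
  let f : Ω → S →ₗ[ℝ] ℝ := fun ω =>
    IsLinearMap.mk'
      (fun φ : S => ∑ l, marginal lam φ (xs l ω, ys l ω) * residual θs (xs l ω, ys l ω))
      ⟨fun v w => by simp [marginal, add_mul, Finset.sum_add_distrib],
        fun c v => by simp [marginal, Finset.mul_sum, Finset.sum_mul, mul_assoc]⟩
  have hf : ∀ ω (φ : S), f ω φ =
    ∑ l, marginal lam φ (xs l ω, ys l ω) * residual θs (xs l ω, ys l ω) := fun _ _ => rfl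
  have hK := devConst_pos (σy := σy) (σ := σ) hσx
  have := uniform_linear (μ := μ) f
    (τ := devConst σx σy σ * (√(h * n) + h)) (π := 2 * Real.exp (-4 * h)) (by positivity)
    (by positivity) fun φ hφ => by
      have hφ' : ‖(φ : EuclideanSpace ℝ (Fin p))‖ = 1 := hφ
      have hm := measurable_marginal lam (φ : EuclideanSpace ℝ (Fin p))
      have hE : HasExpMoment (fun z => marginal lam φ z * residual θs z)
          (expScale σx σy) (expBound σx σy σ) ν := by
        refine (HasExpMoment.mul_of_sq hm (measurable_residual θs)
          (hasExpMoment_sq_of_le hσx hm (by rw [hφ']; nlinarith [sq_nonneg σy])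
            (H.subgaussian_marginal φ))
          (hasExpMoment_sq_of_le hσx (measurable_residual θs) (by nlinarith [sq_nonneg σx])
            H.subgaussian_residual) (expScale_pos hσx)).mono ?_
        have := expScale_pos (σy := σy) hσx
        exact le_mul_of_one_le_right (by positivity) (Real.one_le_exp (by positivity))
      exact H.sample_bernstein hσx hE (H.integral_marginal_mul_residual φ) hh
  simp_rw [hf] at this
  simpa using this

lemma noise_concentration {h : ℝ} (hh : 0 < h) :
    μ.real {ω | devConst σx σy σ * (√(h * n) + h)
        ≤ |∑ l, residual θs (xs l ω, ys l ω) ^ 2 - n * σ ^ 2|}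
      ≤ 2 * Real.exp (-4 * h) := by
  have hE := hasExpMoment_sq_sub (σx := σx) (σy := σy) (σ := σ) hσx
    (measurable_residual θs) (by nlinarith [sq_nonneg σx])
    H.subgaussian_residual (sq_nonneg σ) (by linarith)
  have hi : Integrable (fun z => residual θs z ^ 2) ν := H.memLp_residual.integrable_sq
  have := H.sample_bernstein hσx hE
    (by rw [integral_sub hi (integrable_const _), H.integral_residual_sq]; simp) hh
  simpa using this

end DataAssumptions

end Uniform

/-! ### The pseudo-inverse -/

section LinearAlgebra

variable {n p : ℕ}

lemma norm_toLp_sq {m : ℕ} (v : Fin m → ℝ) : ‖(WithLp.toLp 2 v : EuclideanSpace ℝ (Fin m))‖ ^ 2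
    = v ⬝ᵥ v := by
  rw [EuclideanSpace.norm_sq_eq]
  simp [dotProduct, sq]

lemma transpose_mulVec_dotProduct {m : ℕ} {Q : Matrix (Fin m) (Fin m) ℝ}
    (hQ : Q ∈ Matrix.orthogonalGroup (Fin m) ℝ) (a b : Fin m → ℝ) :
    (Qᵀ *ᵥ a) ⬝ᵥ (Qᵀ *ᵥ b) = a ⬝ᵥ b := by
  have h : Q * Qᵀ = 1 := (Matrix.mem_orthogonalGroup_iff _ _).1 hQ
  rw [Matrix.dotProduct_mulVec, Matrix.vecMul_transpose, Matrix.mulVec_mulVec, h,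
    Matrix.one_mulVec]

lemma mulVec_dotProduct {m : ℕ} {Q : Matrix (Fin m) (Fin m) ℝ}
    (hQ : Q ∈ Matrix.orthogonalGroup (Fin m) ℝ) (a b : Fin m → ℝ) :
    (Q *ᵥ a) ⬝ᵥ (Q *ᵥ b) = a ⬝ᵥ b := by
  have h : Qᵀ * Q = 1 := (Matrix.mem_orthogonalGroup_iff' _ _).1 hQ
  rw [Matrix.dotProduct_mulVec, Matrix.vecMul_mulVec, h, Matrix.vecMul_one]

/-- The inner product of the images of two vectors under rectangular diagonal matrices. -/
lemma rectDiag_dotProduct (hnp : n ≤ p) {M N : Matrix (Fin p) (Fin n) ℝ}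
    (hM : ∀ (i : Fin n) (j : Fin p), i.val ≠ j.val → M j i = 0)
    (hN : ∀ (i : Fin n) (j : Fin p), i.val ≠ j.val → N j i = 0) (a b : Fin n → ℝ) :
    (M *ᵥ a) ⬝ᵥ (N *ᵥ b)
      = ∑ i, (M (i.castLE hnp) i * a i) * (N (i.castLE hnp) i * b i) := by
  have h1 : Mᵀ * N = Matrix.diagonal fun i => M (i.castLE hnp) i * N (i.castLE hnp) i := by
    ext i i'
    rw [Matrix.mul_apply, Finset.sum_eq_single (i.castLE hnp)]
    · rw [Matrix.diagonal_apply, Matrix.transpose_apply]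
      split_ifs with h
      · rw [h]
      · rw [hN i' (i.castLE hnp) fun h' => h (Fin.ext h'.symm), mul_zero]
    · intro j _ hj
      rw [Matrix.transpose_apply, hM i j fun h => hj (Fin.ext h.symm), zero_mul]
    · simp
  rw [Matrix.dotProduct_mulVec, Matrix.vecMul_mulVec, h1, dotProduct]
  refine Finset.sum_congr rfl fun i _ => ?_
  rw [Matrix.vecMul_diagonal]
  ring

lemma yTilde_add (U : Matrix (Fin n) (Fin n) ℝ) (D : Matrix (Fin n) (Fin p) ℝ)
    (a b : Fin n → ℝ) : yTilde U D (a + b) = yTilde U D a + yTilde U D b := by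
  simp [yTilde, Matrix.mulVec_add]

namespace IsSVD

variable {X : Matrix (Fin n) (Fin p) ℝ} {U : Matrix (Fin n) (Fin n) ℝ}
  {D : Matrix (Fin n) (Fin p) ℝ} {V : Matrix (Fin p) (Fin p) ℝ}

lemma diagPinv_apply_eq_zero (h : IsSVD X U D V) (i : Fin n) (j : Fin p) (hij : i.val ≠ j.val) :
    diagPinv D j i = 0 := by
  simp [diagPinv, h.diagonal i j hij]

lemma transpose_mulVec_dotProduct_self (h : IsSVD X U D V) (v : Fin n → ℝ) :
    (Xᵀ *ᵥ v) ⬝ᵥ (Xᵀ *ᵥ v) = (Dᵀ *ᵥ (Uᵀ *ᵥ v)) ⬝ᵥ (Dᵀ *ᵥ (Uᵀ *ᵥ v)) := by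
  have h1 : Xᵀ *ᵥ v = V *ᵥ (Dᵀ *ᵥ (Uᵀ *ᵥ v)) := by
    rw [h.eq, Matrix.transpose_mul, Matrix.transpose_mul, Matrix.transpose_transpose,
      Matrix.mulVec_mulVec, Matrix.mulVec_mulVec, Matrix.mul_assoc]
  rw [h1, mulVec_dotProduct h.orthogonal_right]

/-- `D† Uᵀ X` is a contraction. -/
lemma norm_yTilde_mulVec_le (h : IsSVD X U D V) (hnp : n ≤ p) (θ : EuclideanSpace ℝ (Fin p)) :
    ‖yTilde U D (X *ᵥ θ.ofLp)‖ ≤ ‖θ‖ := by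
  set a := Vᵀ *ᵥ θ.ofLp with ha
  have h1 : Uᵀ *ᵥ (X *ᵥ θ.ofLp) = D *ᵥ a := by
    have hU : Uᵀ * U = 1 := (Matrix.mem_orthogonalGroup_iff' _ _).1 h.orthogonal_left
    rw [h.eq, ha, Matrix.mulVec_mulVec, Matrix.mulVec_mulVec, ← Matrix.mul_assoc,
      ← Matrix.mul_assoc, hU, Matrix.one_mul]
  refine le_of_sq_le_sq ?_ (norm_nonneg _)
  have h2 : ‖θ‖ ^ 2 = a ⬝ᵥ a := by
    rw [ha, transpose_mulVec_dotProduct h.orthogonal_right, ← norm_toLp_sq]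
  have hD : ∀ i : Fin n, (D *ᵥ a) i = D i (i.castLE hnp) * a (i.castLE hnp) := fun i => by
    rw [Matrix.mulVec, dotProduct, Finset.sum_eq_single (i.castLE hnp)]
    · intro j _ hj
      rw [h.diagonal i j fun h' => hj (Fin.ext h'.symm), zero_mul]
    · simp
  rw [yTilde, norm_toLp_sq, h1, h2,
    rectDiag_dotProduct hnp h.diagPinv_apply_eq_zero h.diagPinv_apply_eq_zero]
  calc _ ≤ ∑ i : Fin n, a (i.castLE hnp) * a (i.castLE hnp) := by
        refine Finset.sum_le_sum fun i _ => ?_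
        rw [hD]
        by_cases h0 : D i (i.castLE hnp) = 0
        · simpa [h0] using mul_self_nonneg _
        · simp [diagPinv, h0]
    _ = ∑ j ∈ Finset.univ.map (Fin.castLEEmb hnp), a j * a j := by simp
    _ ≤ ∑ j, a j * a j :=
        Finset.sum_le_univ_sum_of_nonneg fun j => mul_self_nonneg _

/-- Singular values are bounded below by lower bounds for `‖Xᵀ v‖ / ‖v‖`. -/
lemma le_sq_diag (h : IsSVD X U D V) (hnp : n ≤ p) {m : ℝ}
    (hm : ∀ v : Fin n → ℝ, m * (v ⬝ᵥ v) ≤ (Xᵀ *ᵥ v) ⬝ᵥ (Xᵀ *ᵥ v)) (i : Fin n) :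
    m ≤ D i (i.castLE hnp) ^ 2 := by
  have h1 := hm (U *ᵥ Pi.single i 1)
  have hU : Uᵀ * U = 1 := (Matrix.mem_orthogonalGroup_iff' _ _).1 h.orthogonal_left
  rw [mulVec_dotProduct h.orthogonal_left, h.transpose_mulVec_dotProduct_self,
    Matrix.mulVec_mulVec _ Uᵀ U, hU, Matrix.one_mulVec,
    rectDiag_dotProduct hnp (M := Dᵀ) (N := Dᵀ) h.diagonal h.diagonal] at h1
  simpa [Pi.single_apply, sq] using h1

/-- If `m ‖v‖² ≤ ‖Xᵀ v‖²` for all `v`, then `D† Uᵀ` has norm at most `1 / √m`. -/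
lemma mul_norm_yTilde_sq_le (h : IsSVD X U D V) (hnp : n ≤ p) {m : ℝ} (hm0 : 0 < m)
    (hm : ∀ v : Fin n → ℝ, m * (v ⬝ᵥ v) ≤ (Xᵀ *ᵥ v) ⬝ᵥ (Xᵀ *ᵥ v)) (e : Fin n → ℝ) :
    m * ‖yTilde U D e‖ ^ 2 ≤ e ⬝ᵥ e := by
  rw [yTilde, norm_toLp_sq,
    rectDiag_dotProduct hnp h.diagPinv_apply_eq_zero h.diagPinv_apply_eq_zero,
    ← transpose_mulVec_dotProduct h.orthogonal_left e e, dotProduct, Finset.mul_sum]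
  refine Finset.sum_le_sum fun i _ => ?_
  have h1 := h.le_sq_diag hnp hm i
  have h0 : D i (i.castLE hnp) ≠ 0 := fun h0 => by
    rw [h0] at h1; norm_num at h1; linarith
  have h2 : diagPinv D (i.castLE hnp) i = (D i (i.castLE hnp))⁻¹ := rfl
  rw [h2]
  calc _ = (m / D i (i.castLE hnp) ^ 2) * ((Uᵀ *ᵥ e) i * (Uᵀ *ᵥ e) i) := by field_simp
    _ ≤ 1 * ((Uᵀ *ᵥ e) i * (Uᵀ *ᵥ e) i) :=
        mul_le_mul_of_nonneg_right (div_le_one_of_le₀ h1 (sq_nonneg _)) (mul_self_nonneg _)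
    _ = _ := one_mul _

/-- A dual lower bound for `‖D† Uᵀ e‖`, for `X` of full rank. -/
lemma sq_dotProduct_le (h : IsSVD X U D V) (hnp : n ≤ p) {m : ℝ} (hm0 : 0 < m)
    (hm : ∀ v : Fin n → ℝ, m * (v ⬝ᵥ v) ≤ (Xᵀ *ᵥ v) ⬝ᵥ (Xᵀ *ᵥ v)) (e v : Fin n → ℝ) :
    (e ⬝ᵥ v) ^ 2 ≤ ‖yTilde U D e‖ ^ 2 * ((Xᵀ *ᵥ v) ⬝ᵥ (Xᵀ *ᵥ v)) := by
  have h1 : e ⬝ᵥ v = (diagPinv D *ᵥ (Uᵀ *ᵥ e)) ⬝ᵥ (Dᵀ *ᵥ (Uᵀ *ᵥ v)) := by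
    rw [rectDiag_dotProduct hnp (N := Dᵀ) h.diagPinv_apply_eq_zero h.diagonal,
      ← transpose_mulVec_dotProduct h.orthogonal_left e v, dotProduct]
    refine Finset.sum_congr rfl fun i _ => ?_
    have h1 := h.le_sq_diag hnp hm i
    have h0 : D i (i.castLE hnp) ≠ 0 := fun h0 => by
      rw [h0] at h1; norm_num at h1; linarith
    simp only [diagPinv, Matrix.map_apply, Matrix.transpose_apply]
    field_simp
  rw [h1, yTilde, norm_toLp_sq, h.transpose_mulVec_dotProduct_self]
  have := Finset.sum_mul_sq_le_sq_mul_sq Finset.univ (diagPinv D *ᵥ (Uᵀ *ᵥ e))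
    (Dᵀ *ᵥ (Uᵀ *ᵥ v))
  simpa [dotProduct, sq] using this

lemma norm_wTildeTail_le (h : IsSVD X U D V) (w : EuclideanSpace ℝ (Fin p)) :
    ‖wTildeTail n V w‖ ≤ ‖w‖ := by
  refine le_of_sq_le_sq ?_ (norm_nonneg _)
  have h2 : ‖w‖ ^ 2 = (Vᵀ *ᵥ w.ofLp) ⬝ᵥ (Vᵀ *ᵥ w.ofLp) := by
    rw [transpose_mulVec_dotProduct h.orthogonal_right, ← norm_toLp_sq]
  rw [h2, wTildeTail, norm_toLp_sq, dotProduct, dotProduct]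
  refine Finset.sum_le_sum fun j _ => ?_
  split_ifs
  · exact le_rfl
  · simpa using mul_self_nonneg _

end IsSVD

/-- If `T` is bounded below by `√m` and `e` is almost orthogonal to its range, then the component
`v` of `e` orthogonal to the range has almost the full length: with `e - v = T φ`, one has
`m ‖φ‖² ≤ ‖T φ‖² = ⟪T φ, e⟫ ≤ B ‖φ‖`. -/
lemma exists_orthogonal_component {F G : Type*} [NormedAddCommGroup F] [InnerProductSpace ℝ F]
    [NormedAddCommGroup G] [InnerProductSpace ℝ G] [FiniteDimensional ℝ G] (T : F →ₗ[ℝ] G) (e : G)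
    {B m : ℝ} (hm : 0 < m) (h1 : ∀ φ, m * ‖φ‖ ^ 2 ≤ ‖T φ‖ ^ 2)
    (h2 : ∀ φ, |⟪T φ, e⟫| ≤ B * ‖φ‖) :
    ∃ v : G, (∀ φ, ⟪T φ, v⟫ = 0) ∧ ⟪e, v⟫ = ‖v‖ ^ 2 ∧ ‖e‖ ^ 2 - B ^ 2 / m ≤ ‖v‖ ^ 2 := by
  set R := LinearMap.range T
  obtain ⟨φ, hφ⟩ : ∃ φ, T φ = R.starProjection e := by
    have : R.starProjection e ∈ R := Submodule.starProjection_apply_mem _ _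
    exact this
  set v := e - R.starProjection e with hv
  have horth : ∀ ψ, ⟪T ψ, v⟫ = 0 := fun ψ => by
    have : v ∈ Rᗮ := Submodule.sub_starProjection_mem_orthogonal e
    exact this (T ψ) ⟨ψ, rfl⟩
  have hev : e = v + T φ := by rw [hφ, hv]; abel
  have hev2 : ⟪e, v⟫ = ‖v‖ ^ 2 := by
    conv_lhs => rw [hev]
    rw [inner_add_left, horth, real_inner_self_eq_norm_sq, add_zero]
  have hTe : ⟪T φ, e⟫ = ‖T φ‖ ^ 2 := by
    conv_lhs => rw [hev]
    rw [inner_add_right, horth, real_inner_self_eq_norm_sq, zero_add]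
  have hpyth : ‖e‖ ^ 2 = ‖v‖ ^ 2 + ‖T φ‖ ^ 2 := by
    rw [← hev2, ← hTe, real_inner_comm e (T φ), ← inner_add_right, ← hev,
      real_inner_self_eq_norm_sq]
  refine ⟨v, horth, hev2, ?_⟩
  have h3 := h1 φ
  have h4 := h2 φ
  rw [hTe, abs_of_nonneg (sq_nonneg _)] at h4
  have h5 : ‖T φ‖ ^ 2 ≤ B ^ 2 / m := by
    rw [le_div_iff₀ hm]
    nlinarith [sq_nonneg (m * ‖φ‖ - B), norm_nonneg φ]
  linarith

end LinearAlgebra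

/-! ### From the concentration events to the scale -/

section Deterministic

open Module

variable {n p : ℕ}

/-- The span of the first `k` coordinate vectors. -/
def headSpace (p k : ℕ) : Submodule ℝ (EuclideanSpace ℝ (Fin p)) where
  carrier := {φ | ∀ i : Fin p, k ≤ i.val → φ i = 0}
  add_mem' ha hb i hi := by simp [ha i hi, hb i hi]
  zero_mem' i _ := rfl
  smul_mem' c a ha i hi := by simp [ha i hi]

lemma finrank_headSpace_le (p k : ℕ) : finrank ℝ (headSpace p k) ≤ k := by
  let f : headSpace p k →ₗ[ℝ] (Fin k → ℝ) :=
    { toFun := fun φ j => if h : j.val < p then (φ : EuclideanSpace ℝ (Fin p)) ⟨j, h⟩ else 0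
      map_add' := fun a b => by funext j; by_cases h : j.val < p <;> simp [h]
      map_smul' := fun c a => by funext j; by_cases h : j.val < p <;> simp [h] }
  have hf : Function.Injective f := by
    intro a b hab
    ext i
    by_cases hi : i.val < k
    · have := congrFun hab ⟨i, hi⟩
      simpa [f] using this
    · rw [a.2 i (not_lt.1 hi), b.2 i (not_lt.1 hi)]
  simpa using LinearMap.finrank_le_finrank_of_injective hf

lemma whitened_mul_sqrt {lam : Fin p → ℝ} (hlam : ∀ i, 0 < lam i) (i : Fin p)
    (z : EuclideanSpace ℝ (Fin p) × ℝ) : √(lam i) * whitened lam i z = z.1 i := by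
  have : √(lam i) ≠ 0 := (Real.sqrt_pos.2 (hlam i)).ne'
  rw [whitened, mul_inv_cancel_left₀ this]

lemma dataMatrix_dotProduct {lam : Fin p → ℝ} (hlam : ∀ i, 0 < lam i)
    (x : Fin n → EuclideanSpace ℝ (Fin p)) (y : Fin n → ℝ) (v : Fin n → ℝ) :
    ((dataMatrix x)ᵀ *ᵥ v) ⬝ᵥ ((dataMatrix x)ᵀ *ᵥ v)
      = ∑ i, lam i * (∑ l, v l * whitened lam i (x l, y l)) ^ 2 := by
  have h1 : ∀ i, ((dataMatrix x)ᵀ *ᵥ v) i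
      = √(lam i) * ∑ l, v l * whitened lam i (x l, y l) := fun i => by
    rw [Finset.mul_sum, Matrix.mulVec, dotProduct]
    refine Finset.sum_congr rfl fun l _ => ?_
    rw [mul_left_comm, whitened_mul_sqrt hlam]
    simp [dataMatrix, mul_comm]
  rw [dotProduct]
  refine Finset.sum_congr rfl fun i _ => ?_
  rw [h1, mul_mul_mul_comm, Real.mul_self_sqrt (hlam i).le, sq]

/-- If the Gram matrix of the tail features is close to `s I`, the head features are well
conditioned, and the noise `e` is almost uncorrelated with them, then `‖X† e‖²` is close to
`‖e‖² / s`. -/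
lemma norm_yTilde_sq_bounds {lam : Fin p → ℝ} (hlam : ∀ i, 0 < lam i) (hnp : n ≤ p)
    {x : Fin n → EuclideanSpace ℝ (Fin p)} {y : Fin n → ℝ} {e : Fin n → ℝ}
    {U : Matrix (Fin n) (Fin n) ℝ} {D : Matrix (Fin n) (Fin p) ℝ} {V : Matrix (Fin p) (Fin p) ℝ}
    (h : IsSVD (dataMatrix x) U D V) {k : ℕ} {s ρ m B : ℝ} (hs : 0 < s) (hρ0 : 0 ≤ ρ) (hρ : ρ < 1)
    (hm : 0 < m)
    (hgram : ∀ v : EuclideanSpace ℝ (Fin n),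
      |∑ i : Fin p with k ≤ i.val, lam i * (∑ l, v l * whitened lam i (x l, y l)) ^ 2
        - s * ‖v‖ ^ 2| ≤ ρ * s * ‖v‖ ^ 2)
    (hcov : ∀ φ ∈ headSpace p k, m * ‖φ‖ ^ 2 ≤ ∑ l, marginal lam φ (x l, y l) ^ 2)
    (hcross : ∀ φ ∈ headSpace p k, |∑ l, marginal lam φ (x l, y l) * e l| ≤ B * ‖φ‖) :
    (1 - ρ) * s * ‖yTilde U D e‖ ^ 2 ≤ e ⬝ᵥ e ∧
      e ⬝ᵥ e - B ^ 2 / m ≤ (1 + ρ) * s * ‖yTilde U D e‖ ^ 2 := by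
  have hm0 : 0 < (1 - ρ) * s := mul_pos (by linarith) hs
  have hlow : ∀ v : Fin n → ℝ, (1 - ρ) * s * (v ⬝ᵥ v)
      ≤ ((dataMatrix x)ᵀ *ᵥ v) ⬝ᵥ ((dataMatrix x)ᵀ *ᵥ v) := fun v => by
    rw [dataMatrix_dotProduct hlam x y, ← norm_toLp_sq]
    have h1 := (abs_le.1 (hgram (WithLp.toLp 2 v))).1
    have h2 : ∑ i : Fin p with k ≤ i.val, lam i * (∑ l, v l * whitened lam i (x l, y l)) ^ 2
        ≤ ∑ i, lam i * (∑ l, v l * whitened lam i (x l, y l)) ^ 2 :=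
      Finset.sum_le_univ_sum_of_nonneg fun i => mul_nonneg (hlam i).le (sq_nonneg _)
    simp only at h1
    linarith
  refine ⟨h.mul_norm_yTilde_sq_le hnp hm0 hlow e, ?_⟩
  let T : headSpace p k →ₗ[ℝ] EuclideanSpace ℝ (Fin n) :=
    { toFun := fun φ => WithLp.toLp 2 fun l => marginal lam φ (x l, y l)
      map_add' := fun v w => by
        ext l; simp [marginal, add_mul, Finset.sum_add_distrib]
      map_smul' := fun c v => by
        ext l; simp [marginal, Finset.mul_sum, mul_assoc] }
  have hT : ∀ φ l, T φ l = marginal lam φ (x l, y l) := fun _ _ => rfl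
  have hinner : ∀ (a : EuclideanSpace ℝ (Fin n)) (b : EuclideanSpace ℝ (Fin n)),
      ⟪a, b⟫ = ∑ l, a l * b l := fun a b => by
    simp [PiLp.inner_apply, mul_comm]
  obtain ⟨v, hv1, hv2, hv3⟩ := exists_orthogonal_component T (WithLp.toLp 2 e) hm
    (fun φ => by
      rw [EuclideanSpace.norm_sq_eq (T φ)]
      simpa [hT] using hcov φ φ.2)
    (fun φ => by
      rw [hinner]
      simpa [hT] using hcross φ φ.2)
  rw [norm_toLp_sq] at hv3
  -- `v` is orthogonal to the head columns, so only the tail features contribute to `‖Xᵀ v‖²`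
  have hhead : ∀ i : Fin p, i.val < k → ∑ l, v l * whitened lam i (x l, y l) = 0 := by
    intro i hi
    have hmem : EuclideanSpace.single i (1 : ℝ) ∈ headSpace p k := fun j hj => by
      have : j ≠ i := fun hji => by rw [hji] at hj; omega
      simp [this]
    have := hv1 ⟨_, hmem⟩
    rw [hinner] at this
    rw [← this]
    refine Finset.sum_congr rfl fun l _ => ?_
    rw [hT, mul_comm]
    simp [marginal]
  have hX : ((dataMatrix x)ᵀ *ᵥ v.ofLp) ⬝ᵥ ((dataMatrix x)ᵀ *ᵥ v.ofLp)
      ≤ (1 + ρ) * s * ‖v‖ ^ 2 := by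
    rw [dataMatrix_dotProduct hlam x y]
    have h1 := (abs_le.1 (hgram v)).2
    have h2 : ∑ i : Fin p with k ≤ i.val, lam i * (∑ l, v l * whitened lam i (x l, y l)) ^ 2
        = ∑ i, lam i * (∑ l, v l * whitened lam i (x l, y l)) ^ 2 := by
      refine Finset.sum_subset (Finset.subset_univ _) fun i _ hi => ?_
      have hi : i.val < k := by simpa using hi
      rw [hhead i hi]; ring
    linarith
  have hev : e ⬝ᵥ v.ofLp = ‖v‖ ^ 2 := by
    rw [← hv2, hinner]; rfl
  have hdual := h.sq_dotProduct_le hnp hm0 hlow e v.ofLp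
  rw [hev] at hdual
  refine hv3.trans ?_
  rcases (sq_nonneg ‖v‖).eq_or_lt with h0 | h0
  · rw [← h0]; positivity
  · have := hdual.trans (mul_le_mul_of_nonneg_left hX (sq_nonneg _))
    have h3 : ‖v‖ ^ 2 * ‖v‖ ^ 2 ≤ ((1 + ρ) * s * ‖yTilde U D e‖ ^ 2) * ‖v‖ ^ 2 := by
      calc _ = (‖v‖ ^ 2) ^ 2 := by ring
        _ ≤ _ := this
        _ = _ := by ring
    exact le_of_mul_le_mul_right h3 h0

/-- The relative error of `‖X† e‖`, from those of its two bounds. -/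
lemma abs_div_sub_one_le {Q N s ρ ε T2 : ℝ} (hs : 0 < s) (hρ0 : 0 ≤ ρ) (hρ : ρ ≤ 1 / 2)
    (hQ : 0 ≤ Q) (hε : 0 ≤ ε) (hT : 0 < T2) {β : ℝ}
    (h1 : (1 - ρ) * s * Q ^ 2 ≤ N) (h2 : N - β ≤ (1 + ρ) * s * Q ^ 2)
    (h3 : N ≤ (1 + ε) * (s * T2)) (h4 : (1 - ε) * (s * T2) ≤ N - β) :
    |Q / √T2 - 1| ≤ 2 * (ε + ρ) := by
  have hsq : 0 < √T2 := Real.sqrt_pos.2 hT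
  set r := Q / √T2 with hr
  have hr0 : 0 ≤ r := by positivity
  have hQr : Q ^ 2 = r ^ 2 * T2 := by
    rw [hr, div_pow, Real.sq_sqrt hT.le]; field_simp
  have hsT : 0 < s * T2 := mul_pos hs hT
  have h5 : (1 - ρ) * r ^ 2 ≤ 1 + ε := by
    refine le_of_mul_le_mul_right ?_ hsT
    calc _ = (1 - ρ) * s * Q ^ 2 := by rw [hQr]; ring
      _ ≤ _ := h1.trans h3
  have h6 : 1 - ε ≤ (1 + ρ) * r ^ 2 := by
    refine le_of_mul_le_mul_right ?_ hsT
    calc _ ≤ (1 + ρ) * s * Q ^ 2 := h4.trans h2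
      _ = _ := by rw [hQr]; ring
  rw [abs_le]
  constructor
  · by_contra! hcon
    have hr1 : r < 1 := by linarith
    have : r ^ 2 ≤ r := by nlinarith
    nlinarith
  · by_contra! hcon
    have hr1 : 1 < r := by linarith
    have : r ≤ r ^ 2 := by nlinarith
    nlinarith

/-- `α⋆² = (8 w² + √(64 w⁴ + 1296 a²)) / 81` lies between `4 a / 9` and `4 a / 9 + 16 w² / 81`. -/
lemma abs_scale_div_sub_one_le {a w T ε : ℝ} (ha : 0 ≤ a) (hw0 : 0 ≤ w) (hw : w ≤ 1) (hT : 0 < T)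
    (h : |a / T - 1| ≤ ε) :
    |√((8 * w ^ 2 + √(64 * w ^ 4 + 1296 * a ^ 2)) / 81) / (2 * √T / 3) - 1| ≤ ε + 1 / T := by
  set r := √((8 * w ^ 2 + √(64 * w ^ 4 + 1296 * a ^ 2)) / 81) / (2 * √T / 3) with hr
  have hsT : 0 < √T := Real.sqrt_pos.2 hT
  have hr0 : 0 ≤ r := by positivity
  have hr2 : r ^ 2 = (8 * w ^ 2 + √(64 * w ^ 4 + 1296 * a ^ 2)) / (36 * T) := by
    rw [hr, div_pow, div_pow, mul_pow, Real.sq_sqrt (by positivity), Real.sq_sqrt hT.le]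
    field_simp
    ring
  have hlow : 36 * a ≤ √(64 * w ^ 4 + 1296 * a ^ 2) :=
    Real.le_sqrt_of_sq_le (by nlinarith [sq_nonneg (w ^ 2)])
  have hup : √(64 * w ^ 4 + 1296 * a ^ 2) ≤ 8 * w ^ 2 + 36 * a :=
    Real.sqrt_le_iff.2 ⟨by positivity, by nlinarith [mul_nonneg (sq_nonneg w) ha]⟩
  have hw2 : w ^ 2 ≤ 1 := by nlinarith
  have hT1 : 0 < 1 / T := by positivity
  have h1 : a / T ≤ r ^ 2 := by
    rw [hr2, div_le_div_iff₀ hT (by positivity)]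
    nlinarith [sq_nonneg w]
  have h2 : r ^ 2 ≤ a / T + 1 / T := by
    rw [hr2, ← add_div, div_le_div_iff₀ (by positivity) hT]
    nlinarith
  have h3 := abs_le.1 h
  rw [abs_le]
  constructor
  · by_contra! hcon
    have hr1 : r < 1 := by linarith
    nlinarith
  · by_contra! hcon
    have hr1 : 1 < r := by linarith [abs_nonneg (a / T - 1)]
    nlinarith

lemma sqrt_mul_rpow_div {σ s : ℝ} (hσ : 0 < σ) (hs : 0 < s) {m : ℝ} (hm : 0 ≤ m) :
    2 * √σ * m ^ (1 / 4 : ℝ) / (3 * s ^ (1 / 4 : ℝ)) = 2 * √(σ * √(m / s)) / 3 := by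
  have h4 : ∀ x : ℝ, 0 ≤ x → x ^ (1 / 4 : ℝ) = √(√x) := fun x hx => by
    rw [Real.sqrt_eq_rpow, Real.sqrt_eq_rpow, ← Real.rpow_mul hx]
    norm_num
  rw [h4 m hm, h4 s hs.le, Real.sqrt_div hm, Real.sqrt_mul hσ.le, Real.sqrt_div (Real.sqrt_nonneg _)]
  field_simp

end Deterministic

/-! ### Effective ranks and the split index -/

section Ranks

variable {p : ℕ} {lam : Fin p → ℝ}

lemma splitIndex_eq_coe {b : ℝ} {n k : ℕ} (h : splitIndex lam b n = k) :
    k < p ∧ b * n ≤ effRank lam k := by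
  have hne : ((fun j : ℕ => (j : ℕ∞)) '' {j : ℕ | j < p ∧ b * n ≤ effRank lam j}).Nonempty := by
    by_contra hcon
    rw [Set.not_nonempty_iff_eq_empty] at hcon
    rw [splitIndex, hcon, sInf_empty] at h
    exact ENat.natCast_ne_top k h.symm
  have hmem := csInf_mem hne
  rw [← splitIndex, h] at hmem
  obtain ⟨j, hj, hjk⟩ := hmem
  rw [← Nat.cast_injective (R := ℕ∞) hjk]
  exact hj

lemma tailSum_pos (hlam : ∀ i, 0 < lam i) {k : ℕ} (hk : k < p) : 0 < tailSum lam k :=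
  Finset.sum_pos (fun i _ => hlam i) ⟨⟨k, hk⟩, by simp⟩

lemma sum_sq_tail_pos (hlam : ∀ i, 0 < lam i) {k : ℕ} (hk : k < p) :
    0 < ∑ i : Fin p with k ≤ i.val, lam i ^ 2 :=
  Finset.sum_pos (fun i _ => pow_pos (hlam i) 2) ⟨⟨k, hk⟩, by simp⟩

lemma effRank_le_effRankSq (hlam : ∀ i, 0 < lam i) (hanti : Antitone lam) {k : ℕ} (hk : k < p) :
    effRank lam k ≤ effRankSq lam k := by
  have hs := tailSum_pos hlam hk
  have hV := sum_sq_tail_pos hlam hk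
  rw [effRank, dif_pos hk, effRankSq, div_le_div_iff₀ (hlam _) hV, sq, mul_assoc]
  refine mul_le_mul_of_nonneg_left ?_ hs.le
  rw [tailSum, Finset.sum_mul]
  refine Finset.sum_le_sum fun i hi => ?_
  have hi' : k ≤ i.val := by simpa using hi
  have : lam i ≤ lam ⟨k, hk⟩ := hanti (Fin.le_def.2 hi')
  rw [sq]
  exact mul_le_mul_of_nonneg_left this (hlam i).le

end Ranks

/-! ### The concentration event and its consequence -/

section Event

open Module

variable {Ω : Type*} [MeasurableSpace Ω] {μ : Measure Ω} [IsProbabilityMeasure μ] {n p : ℕ}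
  {ν : Measure (EuclideanSpace ℝ (Fin p) × ℝ)} [IsProbabilityMeasure ν]
  {xs : Fin n → Ω → EuclideanSpace ℝ (Fin p)} {ys : Fin n → Ω → ℝ}
  {lam : Fin p → ℝ} {θs : EuclideanSpace ℝ (Fin p)} {σx σy σ κ : ℝ}

lemma five_pow_le_exp (m : ℕ) : (5 : ℝ) ^ m ≤ Real.exp (2 * m) := by
  have h : (5 : ℝ) ≤ Real.exp 2 := by
    have h1 : Real.exp 2 = Real.exp 1 ^ 2 := by rw [← Real.exp_nat_mul]; norm_num
    rw [h1]
    nlinarith [Real.exp_one_gt_d9]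
  calc (5 : ℝ) ^ m ≤ Real.exp 2 ^ m := by gcongr
    _ = _ := by rw [← Real.exp_nat_mul, mul_comm]

/-- The event on which the tail Gram matrix, the head covariance, the noise and the head-noise
correlation all concentrate. The parameter `h` plays the role of `log (2 / δ)`, and `K` is the
constant of Bernstein's inequality. -/
structure GoodEvent (xs : Fin n → Ω → EuclideanSpace ℝ (Fin p)) (ys : Fin n → Ω → ℝ)
    (lam : Fin p → ℝ) (θs : EuclideanSpace ℝ (Fin p)) (σ K : ℝ) (k : ℕ) (h : ℝ) (ω : Ω) :
    Prop where
  gram : ∀ v : EuclideanSpace ℝ (Fin n),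
    |∑ i : Fin p with k ≤ i.val, lam i * (∑ l, v l * whitened lam i (xs l ω, ys l ω)) ^ 2
      - tailSum lam k * ‖v‖ ^ 2|
    ≤ 32 * K * (√(n / effRankSq lam k) + n / effRank lam k) * tailSum lam k * ‖v‖ ^ 2
  covariance : ∀ φ ∈ headSpace p k,
    n / 2 * ‖φ‖ ^ 2 ≤ ∑ l, marginal lam φ (xs l ω, ys l ω) ^ 2
  cross : ∀ φ ∈ headSpace p k,
    |∑ l, marginal lam φ (xs l ω, ys l ω) * residual θs (xs l ω, ys l ω)|
      ≤ 4 * K * √((k + h) * n) * ‖φ‖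
  noise : |∑ l, residual θs (xs l ω, ys l ω) ^ 2 - n * σ ^ 2| ≤ 2 * K * √(h * n)

lemma sqrt_mul_add_le {h m : ℝ} (h0 : 0 ≤ h) (hm : h ≤ m) : √(h * m) + h ≤ 2 * √(h * m) := by
  have : h ≤ √(h * m) := Real.le_sqrt_of_sq_le (by nlinarith)
  linarith

lemma DataAssumptions.goodEvent_probability
    (H : DataAssumptions μ ν xs ys lam θs σx σy σ κ) (hσx : 0 < σx) {k : ℕ} {h η : ℝ}
    (hk : k < p) (hn : 0 < n) (hh : 0 < h) (hkh : k + h ≤ n) (hη : 0 < η) (hkη : k ≤ η * n)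
    (hηK : 128 * devConst σx σy σ * √η ≤ 1) (hη1 : η ≤ 1) :
    μ.real {ω | ¬ GoodEvent xs ys lam θs σ (devConst σx σy σ) k h ω}
      ≤ 2 * Real.exp (-2 * n) + 2 * Real.exp (-2 * η * n) + 4 * Real.exp (-4 * h) := by
  set K := devConst σx σy σ with hK
  have hK0 : 0 < K := devConst_pos hσx
  have hn' : (0 : ℝ) < n := by exact_mod_cast hn
  have hlam := H.lam_pos
  have hs := tailSum_pos hlam hk
  have hV := sum_sq_tail_pos hlam hk
  have hhead := finrank_headSpace_le p k
  have hpow : ∀ {m d : ℕ} {t : ℝ}, d ≤ m → (5 : ℝ) ^ d * (2 * Real.exp (-4 * t))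
      ≤ 2 * Real.exp (2 * m - 4 * t) := fun {m d t} hd => by
    calc (5 : ℝ) ^ d * (2 * Real.exp (-4 * t)) ≤ Real.exp (2 * m) * (2 * Real.exp (-4 * t)) := by
          gcongr
          exact (pow_le_pow_right₀ (by norm_num) hd).trans (five_pow_le_exp m)
      _ = _ := by rw [mul_left_comm, ← Real.exp_add]; ring_nf
  have hk0 : (0 : ℝ) ≤ k := k.cast_nonneg
  -- the four exceptional events; the factor `5 ^ d` is absorbed by the exponent, as `5 ≤ exp 2`
  have e1 := (H.gram_concentration hσx {i : Fin p | k ≤ i.val} (L := lam ⟨k, hk⟩)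
    (V := ∑ i : Fin p with k ≤ i.val, lam i ^ 2)
    (fun i hi => H.lam_antitone (Fin.le_def.2 (by simpa using hi))) le_rfl (hlam _) hn).trans
    ((hpow le_rfl).trans_eq (by ring_nf : _ = 2 * Real.exp (-2 * n)))
  have e2 := (H.covariance_concentration hσx (headSpace p k) (h := η * n) (by positivity)).trans
    ((hpow hhead).trans
      (show _ ≤ 2 * Real.exp (-2 * η * n) by gcongr; linarith))
  have e3 := (H.cross_concentration hσx (headSpace p k) (h := k + h) (by positivity)).trans
    ((hpow hhead).trans
      (show _ ≤ 2 * Real.exp (-4 * h) by gcongr; linarith))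
  have e4 := H.noise_concentration hσx hh
  refine (measureReal_mono (s₂ := ((_ ∪ _) ∪ _) ∪ _) (fun ω hω => ?_)
    (measure_ne_top _ _)).trans ((measureReal_union_le _ _).trans
      (add_le_add ((measureReal_union_le _ _).trans
        (add_le_add ((measureReal_union_le _ _).trans (add_le_add e1 e2)) e3)) e4) |>.trans_eq
        (by ring))
  by_contra hcon
  simp only [Set.mem_union, not_or, Set.mem_ofPred_eq, not_not, not_le] at hcon
  obtain ⟨⟨⟨h1, h2⟩, h3⟩, h4⟩ := hcon
  refine hω ⟨fun v => ?_, fun φ hφ => ?_, fun φ hφ => ?_, ?_⟩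
  · refine (h1 v).trans_eq ?_
    have hr : n / effRank lam k * tailSum lam k = n * lam ⟨k, hk⟩ := by
      have := hlam ⟨k, hk⟩
      rw [effRank, dif_pos hk]
      field_simp
    have hR : √(n / effRankSq lam k) * tailSum lam k
        = √(n * ∑ i : Fin p with k ≤ i.val, lam i ^ 2) := by
      rw [effRankSq, div_div_eq_mul_div, Real.sqrt_div (by positivity), Real.sqrt_sq hs.le]
      field_simp
    rw [← hr, ← hR]
    ring
  · have h5 := (abs_le.1 (h2 φ hφ)).1
    have h6 : √(η * n * n) = √η * n := by
      rw [mul_assoc, Real.sqrt_mul hη.le, Real.sqrt_mul_self hn'.le]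
    have h7 : η ≤ √η := Real.le_sqrt_of_sq_le (by nlinarith)
    have h8 : 32 * (K * (√(η * n * n) + η * n)) ≤ n / 2 := by
      rw [h6]
      calc 32 * (K * (√η * n + η * n)) ≤ 32 * (K * (√η * n + √η * n)) := by gcongr
        _ = (128 * K * √η) * (n / 2) := by ring
        _ ≤ 1 * (n / 2) := by gcongr
        _ = n / 2 := one_mul _
    have h9 := mul_le_mul_of_nonneg_right h8 (sq_nonneg ‖φ‖)
    linarith
  · refine (h3 φ hφ).trans ?_
    have := sqrt_mul_add_le (h := k + h) (m := n) (by positivity) hkh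
    calc _ ≤ 2 * (K * (2 * √((k + h) * n))) * ‖φ‖ := by gcongr
      _ = _ := by ring
  · refine h4.le.trans ?_
    have := sqrt_mul_add_le (h := h) (m := n) hh.le (by linarith)
    calc _ ≤ K * (2 * √(h * n)) := by gcongr
      _ = _ := by ring

/-- On the good event, `α⋆` is close to `2 √T / 3` with `T = σ √(n / s_k)`. -/
lemma GoodEvent.abs_alphaStar_div_sub_one_le {K h : ℝ} {k : ℕ} {ω : Ω} (hσ : 0 < σ) (hK : 0 < K)
    (hω : GoodEvent xs ys lam θs σ K k h ω) (hlam : ∀ i, 0 < lam i) (hk : k < p) (hn : 0 < n)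
    (hnp : n ≤ p) (hh : 0 < h) (hhn : h ≤ n) (hr : 0 < effRank lam k)
    (hρ : 32 * K * (√(n / effRankSq lam k) + n / effRank lam k) ≤ 1 / 2)
    {U : Matrix (Fin n) (Fin n) ℝ} {D : Matrix (Fin n) (Fin p) ℝ} {V : Matrix (Fin p) (Fin p) ℝ}
    (hsvd : IsSVD (dataMatrix fun i => xs i ω) U D V) (hθ : ‖θs‖ ≤ 1)
    {w : EuclideanSpace ℝ (Fin p)} (hw : ‖w‖ ≤ 1) :
    |alphaStar U D V (fun i => ys i ω) w /
        (2 * √σ * (n : ℝ) ^ (1 / 4 : ℝ) / (3 * tailSum lam k ^ (1 / 4 : ℝ))) - 1|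
      ≤ (64 * K + 4 * K / σ ^ 2 + 64 * K ^ 2 / σ ^ 2 + 2 / σ) *
        (√(n / effRankSq lam k) + n / effRank lam k + √(tailSum lam k / n) + √(h / n) + k / n) := by
  have hn' : (0 : ℝ) < n := by exact_mod_cast hn
  have hs := tailSum_pos hlam hk
  set s := tailSum lam k with hsdef
  set A := √(n / effRankSq lam k) + n / effRank lam k with hA
  have hA0 : 0 ≤ A := by positivity
  set C := √(s / n) with hC
  set Δ := √(h / n) with hΔ
  have hΔ0 : 0 ≤ Δ := Real.sqrt_nonneg _
  have hk0 : (0 : ℝ) ≤ k := k.cast_nonneg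
  set e : Fin n → ℝ := fun l => residual θs (xs l ω, ys l ω) with he
  obtain ⟨hb1, hb2⟩ := norm_yTilde_sq_bounds hlam hnp hsvd (e := e) hs (by positivity)
    (by linarith) (by positivity) hω.gram hω.covariance hω.cross
  have hee : e ⬝ᵥ e = ∑ l, residual θs (xs l ω, ys l ω) ^ 2 := by
    simp [dotProduct, he, sq]
  have hnoise := abs_le.1 hω.noise
  rw [← hee] at hnoise
  have hsh : √(h * n) = n * Δ := by
    rw [hΔ, show h * n = n ^ 2 * (h / n) by field_simp, Real.sqrt_mul (by positivity),
      Real.sqrt_sq hn'.le]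
  have hhΔ : h / n ≤ Δ := by
    have : h / n ≤ 1 := div_le_one_of_le₀ hhn hn'.le
    exact Real.le_sqrt_of_sq_le (by nlinarith [show 0 ≤ h / n by positivity])
  -- the relative error of the noise level and of its part in the span of the head features
  set ε := 2 * K / σ ^ 2 * Δ + 32 * K ^ 2 / σ ^ 2 * (k / n + Δ) with hε
  have hε0 : 0 ≤ ε := by positivity
  have hB : (4 * K * √((k + h) * n)) ^ 2 / (n / 2) ≤ n * (32 * K ^ 2 * (k / n + Δ)) := by
    rw [mul_pow, Real.sq_sqrt (by positivity)]
    calc _ = n * (32 * K ^ 2 * (k / n + h / n)) := by field_simp; ring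
      _ ≤ _ := by gcongr
  have hT2 : s * (σ ^ 2 * (n / s)) = n * σ ^ 2 := by field_simp
  have hεn : ε * (n * σ ^ 2) = 2 * K * (n * Δ) + n * (32 * K ^ 2 * (k / n + Δ)) := by
    rw [hε]; field_simp
  have hp1 : 0 ≤ n * (32 * K ^ 2 * (k / n + Δ)) := by positivity
  rw [hsh] at hnoise
  have hQ := abs_div_sub_one_le (Q := ‖yTilde U D e‖) (T2 := σ ^ 2 * (n / s)) (ε := ε) hs
    (by positivity) hρ (norm_nonneg _) hε0 (by positivity) hb1 hb2
    (by rw [hT2, add_mul, hεn]; linarith) (by rw [hT2, sub_mul, hεn]; linarith)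
  rw [Real.sqrt_mul (sq_nonneg _), Real.sqrt_sq hσ.le] at hQ
  set T := σ * √(n / s) with hT
  have hT0 : 0 < T := by positivity
  have hTC : 1 / T = C / σ := by
    rw [hT, hC, Real.sqrt_div hn'.le, Real.sqrt_div hs.le]
    have := Real.sqrt_pos.2 hs
    have := Real.sqrt_pos.2 hn'
    field_simp
  -- the signal contributes at most `‖θ⋆‖` to `‖ỹ‖`
  have hy : yTilde U D (fun i => ys i ω) - yTilde U D e
      = yTilde U D (dataMatrix (fun i => xs i ω) *ᵥ θs.ofLp) := by
    rw [sub_eq_iff_eq_add, ← yTilde_add]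
    congr 1
    funext l
    simp [he, residual, dataMatrix, Matrix.mulVec, dotProduct, PiLp.inner_apply, mul_comm]
  have hyn : |‖yTilde U D (fun i => ys i ω)‖ - ‖yTilde U D e‖| ≤ 1 :=
    (abs_norm_sub_norm_le _ _).trans
      (by rw [hy]; exact (hsvd.norm_yTilde_mulVec_le hnp θs).trans hθ)
  have ha : |‖yTilde U D (fun i => ys i ω)‖ / T - 1|
      ≤ 2 * (ε + 32 * K * A) + 1 / T := by
    have h1 : ‖yTilde U D (fun i => ys i ω)‖ / T - 1 = (‖yTilde U D e‖ / T - 1)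
        + (‖yTilde U D (fun i => ys i ω)‖ - ‖yTilde U D e‖) / T := by ring
    rw [h1]
    refine (abs_add_le _ _).trans (add_le_add hQ ?_)
    rw [abs_div, abs_of_pos hT0]
    gcongr
  have hα := abs_scale_div_sub_one_le (norm_nonneg _) (norm_nonneg (wTildeTail n V w))
    ((hsvd.norm_wTildeTail_le w).trans hw) hT0 ha
  rw [sqrt_mul_rpow_div hσ hs hn'.le]
  refine hα.trans ?_
  rw [hTC, hε]
  have hC0 : 0 ≤ C := Real.sqrt_nonneg _
  have hkn : (0 : ℝ) ≤ k / n := by positivity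
  have key : (64 * K + 4 * K / σ ^ 2 + 64 * K ^ 2 / σ ^ 2 + 2 / σ) * (A + C + Δ + k / n)
      - (2 * (2 * K / σ ^ 2 * Δ + 32 * K ^ 2 / σ ^ 2 * (k / n + Δ) + 32 * K * A) + C / σ + C / σ)
      = (4 * K / σ ^ 2 + 64 * K ^ 2 / σ ^ 2 + 2 / σ) * A
        + (64 * K + 4 * K / σ ^ 2 + 64 * K ^ 2 / σ ^ 2) * C
        + (64 * K + 2 / σ) * Δ + (64 * K + 4 * K / σ ^ 2 + 2 / σ) * (k / n) := by ring
  have : 0 ≤ (4 * K / σ ^ 2 + 64 * K ^ 2 / σ ^ 2 + 2 / σ) * A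
        + (64 * K + 4 * K / σ ^ 2 + 64 * K ^ 2 / σ ^ 2) * C
        + (64 * K + 2 / σ) * Δ + (64 * K + 4 * K / σ ^ 2 + 2 / σ) * (k / n) := by positivity
  linarith

end Event

end LinReg

end

set_option maxHeartbeats 400000 in
theorem mainTheorem6 (σx σy σ κ : ℝ) (hσx : 0 < σx) (hσy : 0 < σy) (hσ : 0 < σ) :
    ∃ c₀ > (0 : ℝ), ∃ c₁ > (0 : ℝ), ∃ c₂ > (0 : ℝ), ∃ c₃ > (0 : ℝ), ∃ c₄ > (0 : ℝ),
    ∃ c₅ > (0 : ℝ), ∃ b₀ > (0 : ℝ), ∀ b ≥ b₀,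
    ∀ (Ω : Type*) [MeasurableSpace Ω] (μ : Measure Ω) [IsProbabilityMeasure μ] (n p : ℕ)
      (ν : Measure (EuclideanSpace ℝ (Fin p) × ℝ)) [IsProbabilityMeasure ν]
      (xs : Fin n → Ω → EuclideanSpace ℝ (Fin p)) (ys : Fin n → Ω → ℝ)
      (lam : Fin p → ℝ) (θs θ0 : EuclideanSpace ℝ (Fin p)) (k : ℕ)
      (U : Ω → Matrix (Fin n) (Fin n) ℝ) (D : Ω → Matrix (Fin n) (Fin p) ℝ)
      (V : Ω → Matrix (Fin p) (Fin p) ℝ) (δ : ℝ),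
      n < p →
      LinReg.DataAssumptions μ ν xs ys lam θs σx σy σ κ →
      (∀ ω, LinReg.IsSVD (LinReg.dataMatrix fun i => xs i ω) (U ω) (D ω) (V ω)) →
      LinReg.splitIndex lam b n = k →
      Real.exp (-c₀ * Real.sqrt n) < δ → δ < 1 →
      c₁ * (n + k) ≤ p →
      c₂ * max (k : ℝ) (LinReg.tailSum lam k) ≤ n →
      ‖θs‖ ≤ c₃ → ‖LinReg.initVec θ0‖ ≤ c₃ →
      1 - c₄ * δ ≤ μ.real {ω |
        |LinReg.alphaStar (U ω) (D ω) (V ω) (fun i => ys i ω) (LinReg.initVec θ0) /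
            (2 * Real.sqrt σ * (n : ℝ) ^ (1 / 4 : ℝ) /
              (3 * LinReg.tailSum lam k ^ (1 / 4 : ℝ))) - 1|
          ≤ c₅ * (Real.sqrt (n / LinReg.effRankSq lam k) + n / LinReg.effRank lam k
              + Real.sqrt (LinReg.tailSum lam k / n) + Real.sqrt (Real.log (2 / δ) / n)
              + k / n)} := by
  set K := LinReg.devConst σx σy σ with hK
  have hK0 : 0 < K := LinReg.devConst_pos hσx
  -- `√η = q` makes the head covariance well conditioned; `b₀ = 1 / η` makes `ρ ≤ 1/2`
  set q : ℝ := 1 / (1 + 128 * K) with hq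
  have hq0 : 0 < q := by positivity
  have hq1 : q ≤ 1 := by rw [hq, div_le_one (by positivity)]; linarith
  have hqK : 128 * K * q ≤ 1 := by
    rw [hq, mul_one_div, div_le_one (by positivity)]; linarith
  set η : ℝ := q ^ 2 with hη
  have hη0 : 0 < η := by positivity
  have hη1 : η ≤ 1 := pow_le_one₀ hq0.le hq1
  have hsqη : √η = q := Real.sqrt_sq hq0.le
  refine ⟨min (1 / 4) (2 * η), by positivity, 1, one_pos, 2 + 1 / η, by positivity, 1, one_pos,
    6, by norm_num, 64 * K + 4 * K / σ ^ 2 + 64 * K ^ 2 / σ ^ 2 + 2 / σ, by positivity,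
    1 / η, by positivity, ?_⟩
  intro b hb Ω _ μ _ n p ν _ xs ys lam θs θ0 k U D V δ hnp H hsvd hsplit hδ0 hδ1 _ hc2 hθ hw
  set c₀ := min (1 / 4) (2 * η) with hc₀
  have hδ : 0 < δ := (Real.exp_pos _).trans hδ0
  have hn : 0 < n := by
    rcases Nat.eq_zero_or_pos n with rfl | h
    · simp at hδ0; linarith
    · exact h
  have hn1 : (1 : ℝ) ≤ n := by exact_mod_cast hn
  -- for `n < 4` the probability bound is void
  rcases lt_or_ge n 4 with hn4 | hn4
  · have h1 : √(n : ℝ) ≤ 2 := by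
      rw [Real.sqrt_le_iff]
      have : (n : ℝ) < 4 := by exact_mod_cast hn4
      exact ⟨by norm_num, by linarith⟩
    have h2 : c₀ * √(n : ℝ) ≤ 1 / 2 := by
      have : c₀ ≤ 1 / 4 := min_le_left _ _
      nlinarith [Real.sqrt_nonneg (n : ℝ)]
    have h3 := Real.add_one_le_exp (-c₀ * √(n : ℝ))
    have : 1 - 6 * δ ≤ 0 := by linarith
    exact this.trans measureReal_nonneg
  obtain ⟨hk, hrank⟩ := LinReg.splitIndex_eq_coe hsplit
  have hn4' : (4 : ℝ) ≤ n := by exact_mod_cast hn4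
  have hk0 : (0 : ℝ) ≤ k := k.cast_nonneg
  have hkn : (2 + 1 / η) * k ≤ n :=
    (mul_le_mul_of_nonneg_left (le_max_left _ _) (by positivity)).trans hc2
  have hkn2 : (k : ℝ) ≤ n / 2 := by
    have : 0 ≤ 1 / η * k := by positivity
    linarith
  have hkη : (k : ℝ) ≤ η * n := by
    calc (k : ℝ) = η * (1 / η * k) := by field_simp
      _ ≤ η * n := by gcongr; linarith
  set h := Real.log (2 / δ) with hh
  have hh0 : 0 < h := Real.log_pos (by rw [lt_div_iff₀ hδ]; linarith)
  have hsn : √(n : ℝ) ≤ n / 2 := by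
    rw [Real.sqrt_le_iff]
    exact ⟨by positivity, by nlinarith⟩
  have hhn2 : h ≤ n / 2 := by
    have h1 : -c₀ * √n < Real.log δ := (Real.lt_log_iff_exp_lt hδ).2 hδ0
    have h2 : c₀ * √(n : ℝ) ≤ 1 / 4 * (n / 2) := by
      gcongr
      exact min_le_left _ _
    rw [hh, Real.log_div two_ne_zero hδ.ne']
    have := Real.log_two_lt_d9
    linarith
  have hgood := H.goodEvent_probability hσx hk hn hh0 (by linarith) hη0 hkη
    (by rw [hsqη]; exact hqK) hη1
  have hr0 : 0 < LinReg.effRank lam k := by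
    rw [LinReg.effRank, dif_pos hk]
    exact div_pos (LinReg.tailSum_pos H.lam_pos hk) (H.lam_pos _)
  -- both effective-rank terms are small by the choice of `b₀`
  have hnr : n / LinReg.effRank lam k ≤ η := by
    rw [div_le_iff₀ hr0]
    calc (n : ℝ) = η * (1 / η * n) := by field_simp
      _ ≤ η * (b * n) := by gcongr
      _ ≤ _ := by gcongr
  have hρ : 32 * K * (√(n / LinReg.effRankSq lam k) + n / LinReg.effRank lam k) ≤ 1 / 2 := by
    have h1 : √(n / LinReg.effRankSq lam k) ≤ q := by
      rw [← hsqη]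
      refine Real.sqrt_le_sqrt ((div_le_div_of_nonneg_left (by positivity) hr0 ?_).trans hnr)
      exact LinReg.effRank_le_effRankSq H.lam_pos H.lam_antitone hk
    have h2 : η ≤ q := by rw [hη]; nlinarith
    calc _ ≤ 32 * K * (q + q) := by gcongr; linarith
      _ = 128 * K * q / 2 := by ring
      _ ≤ 1 / 2 := by linarith
  have hbad : μ.real {ω | ¬ LinReg.GoodEvent xs ys lam θs σ K k h ω} ≤ 6 * δ := by
    refine hgood.trans ?_
    have hsn1 : √(n : ℝ) ≤ n := by linarith
    have h1 : Real.exp (-2 * η * n) ≤ δ := by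
      refine le_trans (Real.exp_le_exp.2 ?_) hδ0.le
      have : c₀ * √(n : ℝ) ≤ 2 * η * n := by
        gcongr
        exact min_le_right _ _
      linarith
    have h2 : Real.exp (-2 * n) ≤ Real.exp (-2 * η * n) := by
      gcongr
      nlinarith
    have h3 : Real.exp (-4 * h) ≤ δ / 2 := by
      calc Real.exp (-4 * h) ≤ Real.exp (-h) := by gcongr; linarith
        _ = δ / 2 := by
          rw [Real.exp_neg, hh, Real.exp_log (by positivity), inv_div]
    linarith
  set G : Set Ω := {ω | LinReg.GoodEvent xs ys lam θs σ K k h ω} with hG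
  have hGmono : μ.real G ≤ μ.real {ω |
        |LinReg.alphaStar (U ω) (D ω) (V ω) (fun i => ys i ω) (LinReg.initVec θ0) /
            (2 * Real.sqrt σ * (n : ℝ) ^ (1 / 4 : ℝ) /
              (3 * LinReg.tailSum lam k ^ (1 / 4 : ℝ))) - 1|
          ≤ (64 * K + 4 * K / σ ^ 2 + 64 * K ^ 2 / σ ^ 2 + 2 / σ) *
            (Real.sqrt (n / LinReg.effRankSq lam k) + n / LinReg.effRank lam k
              + Real.sqrt (LinReg.tailSum lam k / n) + Real.sqrt (h / n) + k / n)} :=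
    measureReal_mono (fun ω hω =>
      LinReg.GoodEvent.abs_alphaStar_div_sub_one_le hσ hK0 hω H.lam_pos hk hn hnp.le hh0
        (by linarith) hr0 hρ (hsvd ω) hθ hw) (measure_ne_top _ _)
  have hcover : (1 : ℝ) ≤ μ.real G + μ.real Gᶜ := by
    have := measureReal_union_le (μ := μ) G Gᶜ
    rwa [Set.union_compl_self, probReal_univ] at this
  have hGc : μ.real Gᶜ ≤ 6 * δ := hbad
  linarith
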